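/- \textbf{Theorem 6.} A \emph{tiling} is an edge-to-edge tiling of the sphere by pentagons (a finite connected cell decomposition of the sphere whose tiles are pentagons) whose tile corners carry labels $\alpha,\beta,\gamma$ such that the same cyclic word of labels is read, counterclockwise or clockwise, along the boundary of every tile. It is a tiling for the anglewise vertex combination $\{f\,t\colon n_1v_1,n_2v_2,\dots\}$ if it has exactly $f$ tiles, each with the multiset $t$ of corner labels, and exactly $n_i$ vertices at which the labels form the multiset $v_i$, and no other vertices. Tilings are identified if there is a label preserving isomorphism of cell decompositions between them, which may reverse the orientation. The \emph{pentagonal subdivision} of a polyhedron: divide every edge into three segments by two new vertices, and join the centre of every face, for every edge on its boundary (directed counterclockwise around the face), to the second of the two new vertices on that edge. This gives one pentagon for every pair of a face and a vertex of it; label its corners counterclockwise by $\epsilon,\alpha,\delta,\beta,\gamma$, with $\epsilon$ at the centre of the face and $\delta$ at the vertex of the polyhedron. Let $PP_6$ and $PP_{12}$ be the pentagonal subdivisions of the cube and of the dodecahedron. The ${\rm 3D}_1$, ${\rm 3D}_2$, ${\rm 3D}_3$ reductions change the labels $\alpha,\beta,\gamma,\delta,\epsilon$ to $\beta,\alpha,\alpha,\beta,\gamma$,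 to $\alpha,\beta,\alpha,\beta,\gamma$, and to $\alpha,\alpha,\beta,\beta,\gamma$, respectively. (1) The tilings for $\text{AVC(3D24)}=\{24\alpha^2\beta^2\gamma\colon 24\alpha^2\beta,\,8\beta^3,\,6\gamma^4\}$ are exactly the ${\rm 3D}_1$, ${\rm 3D}_2$, ${\rm 3D}_3$ reductions of $PP_6$ and two further tilings. These two are obtained from the ${\rm 3D}_3$ reduction and from the ${\rm 3D}_1$ reduction of $PP_6$, respectively, by exchanging $\alpha$ and $\beta$ in the following $16$ tiles: all tiles in the bottom face and in the top face of the cube, and in each lateral face, seen from outside, the tiles at the bottom right and at the top left vertex. (2) The tilings for $\text{AVC(3D60)}=\{60\alpha^2\beta^2\gamma\colon 60\alpha^2\beta,\,20\beta^3,\,12\gamma^5\}$ are exactly the ${\rm 3D}_1$, ${\rm 3D}_2$, ${\rm 3D}_3$ reductions of $PP_{12}$. (3) The two further tilings in (1) are different from each other, and neither of them is obtained from $PP_6$ by any change of the labels $\alpha,\beta,\gamma,\delta,\epsilon$ to labels among $\alpha,\beta,\gamma$. Both of them mix the two types of tile neighbourhoods $N(\gamma^4)$ of a vertex $\gamma^4$: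 writing ${}^x\gamma^y$ for a corner $\gamma$ together with the two corners $x,y$ adjacent to it in its tile, in the cyclic order around the vertex, every vertex $\gamma^4$ is of the form $|^{\alpha}\gamma^{\beta}|^{\alpha}\gamma^{\beta}|^{\alpha}\gamma^{\beta}|^{\alpha}\gamma^{\beta}|$ (read in one of the two directions) or $|^{\alpha}\gamma^{\beta}|^{\beta}\gamma^{\alpha}|^{\alpha}\gamma^{\beta}|^{\beta}\gamma^{\alpha}|$, and both forms occur. -/

import Mathlib

namespace PentTiling

/-- Labels of the five corners of the pentagon with all corners distinguished. -/
inductive Label5 | α | β | γ | δ | ε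
  deriving DecidableEq

instance : Fintype Label5 where
  elems := {.α, .β, .γ, .δ, .ε}
  complete c := by cases c <;> decide

/-- Labels of the corners when only three labels are distinguished. -/
inductive Label3 | α | β | γ
  deriving DecidableEq

instance : Fintype Label3 where
  elems := {.α, .β, .γ}
  complete c := by cases c <;> decide

/-! ### Oriented maps

A cell decomposition of an oriented surface, given by its rotation system. The elements of `D`
are the darts. A dart is an edge of the decomposition together with a direction; the tile of the
dart is the one on the left of this directed edge. At the same time a dart stands for a corner,
namely the corner of its tile at the source of the directed edge. -/

/-- `face d` is the next dart counterclockwise along the boundary of the tile of `d`, and `edge d`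
is the same edge with the opposite direction. -/
structure OrientedMap (D : Type*) where
  face : Equiv.Perm D
  edge : Equiv.Perm D
  edge_edge : ∀ d, edge (edge d) = d
  edge_ne : ∀ d, edge d ≠ d

namespace OrientedMap

variable {D : Type*}

/-- Rotation around the source of a dart. The cycles of `vertex`, `edge`, `face` are the vertices,
the edges and the tiles of the decomposition. -/
def vertex (M : OrientedMap D) : Equiv.Perm D := M.face * M.edge

/-- The surface is connected. -/
def IsConnected (M : OrientedMap D) : Prop :=
  ∀ x y : D, ∃ g ∈ Subgroup.closure ({M.face, M.edge} : Set (Equiv.Perm D)), g x = y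

end OrientedMap

/-- The set of cycles (fixed points included) of a permutation. -/
abbrev Cycles {D : Type*} (σ : Equiv.Perm D) : Type _ := Quotient (Equiv.Perm.SameCycle.setoid σ)

/-- The surface is the sphere: it is connected and `V - E + F = 2`. -/
def OrientedMap.IsSphere {D : Type*} (M : OrientedMap D) : Prop :=
  M.IsConnected ∧
    Nat.card (Cycles M.vertex) + Nat.card (Cycles M.face) = Nat.card (Cycles M.edge) + 2

/-- An oriented map all of whose corners are labelled. -/
structure LabelledMap (D A : Type*) extends OrientedMap D where
  label : D → A

open Classical in
/-- For every cycle of `σ` the multiset of the labels along the cycle. -/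
noncomputable def cycleLabels {D A : Type*} [Fintype D] (σ : Equiv.Perm D) (label : D → A) :
    Multiset (Multiset A) :=
  (Finset.univ : Finset (Cycles σ)).val.map fun c =>
    (Finset.univ.filter fun d : D => (Quotient.mk _ d : Cycles σ) = c).val.map label

/-- An anglewise vertex combination `{f t : vertices}`: there are `f` tiles, the corners of each
tile form the multiset `t`, and `vertices` is the multiset of the angle combinations at all
vertices. -/
structure AVC (A : Type*) where
  numTiles : ℕ
  tile : Multiset A
  vertices : Multiset (Multiset A)

namespace LabelledMap

variable {D D' A B : Type*}

/-- All tiles are pentagons. -/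
def IsPentagonal (T : LabelledMap D A) : Prop :=
  ∀ d, (T.face ^ 5) d = d ∧ T.face d ≠ d

/-- All tiles are corner congruent: there is one cyclic word of labels that is read along the
boundary of every tile, counterclockwise or clockwise. -/
def IsCornerCongruent (T : LabelledMap D A) : Prop :=
  ∃ w : ZMod 5 → A, ∀ d : D, ∃ k : ZMod 5,
    (∀ i : ℕ, T.label ((T.face ^ i) d) = w (k + i)) ∨
    (∀ i : ℕ, T.label ((T.face ^ i) d) = w (k - i))

/-- Tilings of the sphere by corner congruent pentagons with the given AVC. -/
structure IsTilingFor [Fintype D] (T : LabelledMap D A) (V : AVC A) : Prop where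
  sphere : T.IsSphere
  pentagonal : T.IsPentagonal
  congruent : T.IsCornerCongruent
  tiles : cycleLabels T.face T.label = Multiset.replicate V.numTiles V.tile
  vertices : cycleLabels T.vertex T.label = V.vertices

/-- Change the labels; identifying labels this way is a reduction. -/
def relabel (T : LabelledMap D A) (r : A → B) : LabelledMap D B where
  toOrientedMap := T.toOrientedMap
  label := r ∘ T.label

/-- The mirror image. As elements of `D` are corners and a corner is named after the dart that
leaves it counterclockwise along its tile, the corner `d` is in the mirror image the dart along
the reverse of `face⁻¹ d`. -/
def mirror (T : LabelledMap D A) : LabelledMap D A where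
  face := T.face⁻¹
  edge := T.face * T.edge * T.face⁻¹
  edge_edge d := by simp [T.edge_edge]
  edge_ne d h := T.edge_ne (T.face⁻¹ d) (T.face.injective (by simpa using h))
  label := T.label

/-- Orientation preserving isomorphism of labelled maps. -/
def Isomorphic (T : LabelledMap D A) (T' : LabelledMap D' A) : Prop :=
  ∃ f : D ≃ D', (∀ d, f (T.face d) = T'.face (f d)) ∧ (∀ d, f (T.edge d) = T'.edge (f d)) ∧
    ∀ d, T'.label (f d) = T.label d

/-- Being the same tiling: isomorphic, possibly after taking the mirror image. -/
def Equivalent (T : LabelledMap D A) (T' : LabelledMap D' A) : Prop :=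
  T.Isomorphic T' ∨ T.Isomorphic T'.mirror

end LabelledMap

/-! ### Cube and dodecahedron -/

section Polyhedron

variable {m k n : ℕ}

/-- `F i` lists the vertices of the `i`-th face in counterclockwise order; the dart `(i, j)` leads
from the `j`-th vertex of the face to the next one. -/
def src (F : Fin m → Fin k → Fin n) (d : Fin m × Fin k) : Fin n := F d.1 d.2

/-- The vertex to which a dart leads. -/
def tgt (F : Fin m → Fin k → Fin n) (d : Fin m × Fin k) : Fin n := F d.1 (finRotate k d.2)

/-- The dart along the same edge with the opposite direction. -/
def opposite (F : Fin m → Fin k → Fin n)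
    (h : ∀ d, ∃! d', src F d' = tgt F d ∧ tgt F d' = src F d) (d : Fin m × Fin k) :
    Fin m × Fin k :=
  Fintype.choose _ (h d)

theorem opposite_spec (F : Fin m → Fin k → Fin n)
    (h : ∀ d, ∃! d', src F d' = tgt F d ∧ tgt F d' = src F d) (d : Fin m × Fin k) :
    src F (opposite F h d) = tgt F d ∧ tgt F (opposite F h d) = src F d :=
  Fintype.choose_spec _ (h d)

theorem opposite_opposite (F : Fin m → Fin k → Fin n)
    (h : ∀ d, ∃! d', src F d' = tgt F d ∧ tgt F d' = src F d) :
    Function.Involutive (opposite F h) := fun d =>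
  (h (opposite F h d)).unique (opposite_spec F h _)
    ⟨(opposite_spec F h d).2.symm, (opposite_spec F h d).1.symm⟩

/-- The oriented map of a polyhedron given by its faces. -/
def polyhedron (F : Fin m → Fin k → Fin n)
    (h : ∀ d, ∃! d', src F d' = tgt F d ∧ tgt F d' = src F d) (h' : ∀ d, src F d ≠ tgt F d) :
    OrientedMap (Fin m × Fin k) where
  face := Equiv.prodCongr (Equiv.refl _) (finRotate k)
  edge := (opposite_opposite F h).toPerm
  edge_edge := opposite_opposite F h
  edge_ne d e := h' d (by
    have := (opposite_spec F h d).1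
    rwa [show opposite F h d = d from e] at this)

end Polyhedron

/-- The faces of the cube, seen from outside: bottom, top, and the four lateral faces. The bottom
vertices are `0, 1, 2, 3`, the vertices above them `4, 5, 6, 7`. A lateral face starts with its
bottom left vertex. -/
def cubeFaces : Fin 6 → Fin 4 → Fin 8 :=
  ![![0, 3, 2, 1], ![4, 5, 6, 7],
    ![0, 1, 5, 4], ![1, 2, 6, 5], ![2, 3, 7, 6], ![3, 0, 4, 7]]

/-- The cube `P_6`. -/
def cube : OrientedMap (Fin 6 × Fin 4) :=
  polyhedron cubeFaces (by simp only [ExistsUnique]; decide) (by decide)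

/-- The faces of the dodecahedron, seen from outside: top, five upper, five lower, bottom. -/
def dodecahedronFaces : Fin 12 → Fin 5 → Fin 20 :=
  ![![0, 1, 2, 3, 4],
    ![1, 0, 5, 10, 6], ![2, 1, 6, 11, 7], ![3, 2, 7, 12, 8], ![4, 3, 8, 13, 9], ![0, 4, 9, 14, 5],
    ![6, 10, 15, 16, 11], ![7, 11, 16, 17, 12], ![8, 12, 17, 18, 13], ![9, 13, 18, 19, 14],
    ![5, 14, 19, 15, 10],
    ![19, 18, 17, 16, 15]]

set_option maxRecDepth 100000 in
set_option maxHeartbeats 4000000 in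
/-- The dodecahedron `P_12`. -/
def dodecahedron : OrientedMap (Fin 12 × Fin 5) :=
  polyhedron dodecahedronFaces (by simp only [ExistsUnique]; decide) (by decide)

/-! ### Pentagonal subdivision -/

/-- The corners of the pentagon in counterclockwise order: `ε, α, δ, β, γ`. -/
def nextCorner : Equiv.Perm Label5 where
  toFun | .ε => .α | .α => .δ | .δ => .β | .β => .γ | .γ => .ε
  invFun | .α => .ε | .δ => .α | .β => .δ | .γ => .β | .ε => .γ
  left_inv c := by cases c <;> rfl
  right_inv c := by cases c <;> rfl

/-- Opposite darts in the pentagonal subdivision, see `pentSubdivision`. -/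
def subdivisionEdge {D : Type*} (M : OrientedMap D) : D × Label5 → D × Label5
  | (d, .ε) => (M.face⁻¹ d, .γ)
  | (d, .γ) => (M.face d, .ε)
  | (d, .α) => (M.edge (M.face⁻¹ d), .δ)
  | (d, .δ) => (M.face (M.edge d), .α)
  | (d, .β) => (M.edge d, .β)

theorem subdivisionEdge_involutive {D : Type*} (M : OrientedMap D) :
    Function.Involutive (subdivisionEdge M) := by
  rintro ⟨d, c⟩
  cases c <;> simp [subdivisionEdge, M.edge_edge]

/-- The pentagonal subdivision of `M`, with the corners of its tiles labelled. Every edge of `M` is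
divided into three segments by two new vertices, and the centre of every face of `M` is joined, for
every edge on the boundary of the face (in counterclockwise direction), to the second of the
two new vertices on that edge. This cuts the face into one pentagon for each of its corners `d`.
The vertices of this pentagon are, counterclockwise: the centre of the face (`ε`), the second new
vertex on `face⁻¹ d` (`α`), the source of `d` (`δ`), and the first and the second new vertex on
`d` (`β` and `γ`). The dart `(d, c)` is the side of this pentagon that starts at its corner `c`. -/
def pentSubdivision {D : Type*} (M : OrientedMap D) : LabelledMap (D × Label5) Label5 where
  face := Equiv.prodCongr (Equiv.refl D) nextCorner
  edge := (subdivisionEdge_involutive M).toPerm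
  edge_edge := subdivisionEdge_involutive M
  edge_ne := by
    rintro ⟨d, c⟩ h
    have h : subdivisionEdge M (d, c) = (d, c) := h
    cases c <;> simp [subdivisionEdge] at h
    exact M.edge_ne d h
  label x := x.2

/-- The pentagonal subdivision `PP_6` of the cube. -/
def PP6 : LabelledMap ((Fin 6 × Fin 4) × Label5) Label5 := pentSubdivision cube

/-- The pentagonal subdivision `PP_12` of the dodecahedron. -/
def PP12 : LabelledMap ((Fin 12 × Fin 5) × Label5) Label5 := pentSubdivision dodecahedron

/-! ### The AVCs and the tilings -/

/-- `AVC(3D24) = {24 α²β²γ : 24 α²β, 8 β³, 6 γ⁴}`. -/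
def AVC3D24 : AVC Label3 where
  numTiles := 24
  tile := {.α, .α, .β, .β, .γ}
  vertices := Multiset.replicate 24 {.α, .α, .β} + Multiset.replicate 8 {.β, .β, .β} +
    Multiset.replicate 6 {.γ, .γ, .γ, .γ}

/-- `AVC(3D60) = {60 α²β²γ : 60 α²β, 20 β³, 12 γ⁵}`. -/
def AVC3D60 : AVC Label3 where
  numTiles := 60
  tile := {.α, .α, .β, .β, .γ}
  vertices := Multiset.replicate 60 {.α, .α, .β} + Multiset.replicate 20 {.β, .β, .β} +
    Multiset.replicate 12 {.γ, .γ, .γ, .γ, .γ}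

/-- The reduction `3D₁`: `α, β, γ, δ, ε → β, α, α, β, γ`. -/
def red3D1 : Label5 → Label3
  | .α => .β | .β => .α | .γ => .α | .δ => .β | .ε => .γ

/-- The reduction `3D₂`: `α, β, γ, δ, ε → α, β, α, β, γ`. -/
def red3D2 : Label5 → Label3
  | .α => .α | .β => .β | .γ => .α | .δ => .β | .ε => .γ

/-- The reduction `3D₃`: `α, β, γ, δ, ε → α, α, β, β, γ`. -/
def red3D3 : Label5 → Label3
  | .α => .α | .β => .α | .γ => .β | .δ => .β | .ε => .γ

/-- Exchange of `α` and `β`. -/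
def swapAB : Label3 → Label3
  | .α => .β | .β => .α | .γ => .γ

/-- The tiles of `PP6` that are flipped in the two further tilings: all tiles in the bottom and in
the top face of the cube, and in every lateral face the tiles at the bottom right and at the top
left vertex. -/
def isFlipped (d : Fin 6 × Fin 4) : Bool :=
  d.1 = 0 || d.1 = 1 || d.2 = 1 || d.2 = 3

/-- The reduction of `PP6` by `r`, modified by exchanging the labels `α` and `β` in the flipped
tiles. -/
def flippedPP6 (r : Label5 → Label3) : LabelledMap ((Fin 6 × Fin 4) × Label5) Label3 where
  toOrientedMap := PP6.toOrientedMap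
  label x := if isFlipped x.1 then swapAB (r x.2) else r x.2

/-- The further tiling by the pentagon of the `3D₃` reduction
(cyclic corner word `γ, α, β, α, β`). -/
def extraTiling3 : LabelledMap ((Fin 6 × Fin 4) × Label5) Label3 := flippedPP6 red3D3

/-- The further tiling by the pentagon of the `3D₁` reduction
(cyclic corner word `γ, α, α, β, β`). -/
def extraTiling1 : LabelledMap ((Fin 6 × Fin 4) × Label5) Label3 := flippedPP6 red3D1

/-! ### The two types of `N(γ⁴)` -/

namespace LabelledMap

variable {D : Type*}

/-- The corner `d` is at a vertex `γ⋯γ` with adjacent angle deduction `|ᵅγᵝ|ᵅγᵝ|⋯|ᵅγᵝ|`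
(read in one of the two directions). -/
def IsRoundAt (T : LabelledMap D Label3) (d : D) : Prop :=
  (∀ x, T.vertex.SameCycle d x → T.label x = .γ ∧
    T.label (T.face⁻¹ x) = .α ∧ T.label (T.face x) = .β) ∨
  (∀ x, T.vertex.SameCycle d x → T.label x = .γ ∧
    T.label (T.face⁻¹ x) = .β ∧ T.label (T.face x) = .α)

/-- The corner `d` is at a vertex `γ⋯γ` with adjacent angle deduction
`|ᵅγᵝ|ᵝγᵅ|⋯|ᵅγᵝ|ᵝγᵅ|`. -/
def IsSquareAt (T : LabelledMap D Label3) (d : D) : Prop :=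
  ∀ x, T.vertex.SameCycle d x → T.label x = .γ ∧
    (T.label (T.face⁻¹ x) = .α ∧ T.label (T.face x) = .β ∧
        T.label (T.face⁻¹ (T.vertex x)) = .β ∧ T.label (T.face (T.vertex x)) = .α ∨
      T.label (T.face⁻¹ x) = .β ∧ T.label (T.face x) = .α ∧
        T.label (T.face⁻¹ (T.vertex x)) = .α ∧ T.label (T.face (T.vertex x)) = .β)

/-- Both types of `N(γ⁴)`, and no others, occur. -/
def IsMixed (T : LabelledMap D Label3) : Prop :=
  (∀ d, T.label d = .γ → T.IsRoundAt d ∨ T.IsSquareAt d) ∧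
    (∃ d, T.IsRoundAt d) ∧ ∃ d, T.IsSquareAt d

end LabelledMap

end PentTiling

open PentTiling

namespace PentTiling

/-! ### Labels along the cycles of a permutation -/

section Orbits

variable {D D' A : Type*}

/-! Geometry. Every tile has exactly one corner γ, and a vertex containing γ is a vertex γᵏ. Naming
the corners of a tile ε, α, δ, β, γ counterclockwise from that corner, the side γε of a tile is
glued to the side εα of the next tile around γᵏ, so the tiles fall into k-gons centred at the
vertices γᵏ. The outer end of such a side has degree three, and its third corner can only be β or δ.
Connectedness forces the same choice everywhere (`isRegularAt_of_isRegularAt`), and taking the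
mirror image exchanges the two choices. Hence, up to orientation, the tiling is the pentagonal
subdivision of a connected map `M` with `face ^ k = 1` and `vertex ^ 3 = 1`, having one dart per
tile (`IsTilingFor.exists_labelledSubdivision`). Such a map with 24 darts and k = 4 is the cube, and
with 60 darts and k = 5 the dodecahedron: an equivariant map from the darts of the polyhedron is
built face by face; it is onto by connectedness and bijective by counting.

Labels. The common cyclic word, cut at γ, is an arrangement of α, α, β, β, read in each tile
forwards or backwards. Up to reversal there are four arrangements. One would put α at every corner δ
and is impossible; the palindrome αββα gives 3D₂; the other two give 3D₁ and 3D₃, where reading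
backwards amounts to exchanging α and β (`exists_flipLabel`). Both α²β and β³ contain an even number
of α, so the exchanged tiles form a solution of a linear system over 𝔽₂, `IsFlip`. Its solutions
alternate around each face and are determined by two values. If k is odd only zero remains
(`eq_false_of_odd`). On the cube every nonzero solution exchanges two neighbouring tiles of some
face, and moving them to a standard position by a symmetry leaves the single solution `isFlipped`,
which gives one further tiling for each of 3D₁ and 3D₃.

Conversely, the local conditions determine all the numbers, including the Euler characteristic, by
counting labels. The further tilings are no relabellings of the subdivided cube because their tiles
carry the word in both directions. -/

theorem cycles_mk_eq_iff {σ : Equiv.Perm D} {x y : D} :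
    (Quotient.mk _ x : Cycles σ) = Quotient.mk _ y ↔ σ.SameCycle x y :=
  Quotient.eq (r := Equiv.Perm.SameCycle.setoid σ)

theorem iff_of_sameCycle {σ : Equiv.Perm D} {p : D → Prop} (h : ∀ x, p (σ x) ↔ p x)
    {x y : D} (hxy : σ.SameCycle x y) : p x ↔ p y := by
  obtain ⟨i, rfl⟩ := hxy
  induction i with
  | zero => simp
  | succ i ih => rw [add_comm, zpow_add, Equiv.Perm.mul_apply, zpow_one, h]; exact ih
  | pred i ih =>
    rw [ih, sub_eq_add_neg, add_comm, zpow_add, Equiv.Perm.mul_apply, zpow_neg_one,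
      ← h (σ⁻¹ _), ← Equiv.Perm.mul_apply σ, mul_inv_cancel, Equiv.Perm.one_apply]

variable [Fintype D] [Fintype D']

open Classical in
/-- The multiset of the labels along the cycle of `d`. -/
noncomputable def orbitLabels (σ : Equiv.Perm D) (label : D → A) (d : D) : Multiset A :=
  (Finset.univ.filter fun x : D => σ.SameCycle x d).val.map label

theorem mem_cycleLabels {σ : Equiv.Perm D} {label : D → A} {m : Multiset A} :
    m ∈ cycleLabels σ label ↔ ∃ d, orbitLabels σ label d = m := by
  simp only [cycleLabels, orbitLabels, Multiset.mem_map, Finset.mem_val, Finset.mem_univ, true_and]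
  constructor
  · rintro ⟨c, rfl⟩
    induction c using Quotient.inductionOn with | _ d =>
    refine ⟨d, ?_⟩; congr 2; ext x; simp [cycles_mk_eq_iff]
  · rintro ⟨d, rfl⟩
    refine ⟨Quotient.mk _ d, ?_⟩; congr 2; ext x; simp [cycles_mk_eq_iff]

/-- Each dart lies on exactly one cycle. This identity is the source of all counts of tiles, edges
and vertices. -/
theorem sum_cycleLabels (σ : Equiv.Perm D) (label : D → A) :
    (cycleLabels σ label).sum = (Finset.univ : Finset D).val.map label := by
  classical
  have key : ∀ s : Finset D, s.val.map label = ∑ d ∈ s, ({label d} : Multiset A) := by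
    intro s
    rw [← Multiset.sum_map_singleton (s.val.map label), Multiset.map_map]
    rfl
  rw [key, ← Finset.sum_fiberwise (s := Finset.univ) (g := fun d => (Quotient.mk _ d : Cycles σ))]
  simp only [← key]
  rfl

theorem card_cycleLabels (σ : Equiv.Perm D) (label : D → A) :
    (cycleLabels σ label).card = Nat.card (Cycles σ) := by
  classical
  rw [cycleLabels, Multiset.card_map, Finset.card_val, Finset.card_univ, Nat.card_eq_fintype_card]

open Classical in
theorem cycleLabels_congr {σ : Equiv.Perm D} {σ' : Equiv.Perm D'} {label : D → A}
    {label' : D' → A} (e : D ≃ D') (h : ∀ x y, σ.SameCycle x y ↔ σ'.SameCycle (e x) (e y))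
    (hl : ∀ x, label' (e x) = label x) : cycleLabels σ label = cycleLabels σ' label' := by
  have ho : ∀ d, orbitLabels σ label d = orbitLabels σ' label' (e d) := by
    intro d
    have : (Finset.univ.filter fun x : D' => σ'.SameCycle x (e d)) =
        (Finset.univ.filter fun x : D => σ.SameCycle x d).map e.toEmbedding := by
      ext x
      simp only [Finset.mem_filter, Finset.mem_univ, true_and, Finset.mem_map_equiv]
      rw [h, Equiv.apply_symm_apply]
    rw [orbitLabels, orbitLabels, this, Finset.map_val, Multiset.map_map]
    exact Multiset.map_congr rfl fun x _ => (hl x).symm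
  let q : Cycles σ ≃ Cycles σ' := Quotient.congr e h
  rw [cycleLabels, cycleLabels, ← Multiset.map_univ_val_equiv q, Multiset.map_map]
  refine Multiset.map_congr rfl fun c _ => ?_
  induction c using Quotient.inductionOn with | _ d =>
  have h2 : q (Quotient.mk _ d) = Quotient.mk _ (e d) := rfl
  have := ho d
  simp only [orbitLabels, ← cycles_mk_eq_iff] at this
  simp only [Function.comp_apply, h2]
  exact this

theorem orbitLabels_eq_of_minimalPeriod (σ : Equiv.Perm D) (label : D → A) (d : D) :
    orbitLabels σ label d =
      (Multiset.range (Function.minimalPeriod σ d)).map fun i => label ((σ ^ i) d) := by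
  classical
  have hp : d ∈ Function.periodicPts σ := σ.injective.mem_periodicPts d
  have hinj : Set.InjOn (fun i => (σ ^ i) d)
      (Finset.range (Function.minimalPeriod σ d) : Set ℕ) := by
    intro i hi j hj hij
    rw [Finset.mem_coe, Finset.mem_range] at hi hj
    refine Function.iterate_injOn_Iio_minimalPeriod hi hj ?_
    simpa only [Equiv.Perm.iterate_eq_pow] using hij
  have himg : (Finset.univ.filter fun x : D => σ.SameCycle x d) =
      (Finset.range (Function.minimalPeriod σ d)).image fun i => (σ ^ i) d := by
    ext x
    simp only [Finset.mem_filter, Finset.mem_univ, true_and, Finset.mem_image, Finset.mem_range]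
    constructor
    · intro h
      obtain ⟨i, rfl⟩ := h.symm.exists_nat_pow_eq
      refine ⟨i % Function.minimalPeriod σ d,
        Nat.mod_lt _ (Function.minimalPeriod_pos_of_mem_periodicPts hp), ?_⟩
      simpa only [Equiv.Perm.iterate_eq_pow] using
        Function.iterate_mod_minimalPeriod_eq (f := σ) (x := d) (n := i)
    · rintro ⟨i, -, rfl⟩
      exact Equiv.Perm.SameCycle.symm ⟨i, by simp⟩
  rw [orbitLabels, himg, Finset.image_val_of_injOn hinj, Multiset.map_map]
  rfl

theorem card_orbitLabels (σ : Equiv.Perm D) (label : D → A) (d : D) :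
    (orbitLabels σ label d).card = Function.minimalPeriod σ d := by
  rw [orbitLabels_eq_of_minimalPeriod, Multiset.card_map, Multiset.card_range]

theorem pow_card_orbitLabels (σ : Equiv.Perm D) (label : D → A) (d : D) :
    (σ ^ (orbitLabels σ label d).card) d = d := by
  rw [card_orbitLabels, ← Equiv.Perm.iterate_eq_pow]
  exact Function.iterate_minimalPeriod

theorem mem_orbitLabels_pow (σ : Equiv.Perm D) (label : D → A) (d : D) (i : ℕ) :
    label ((σ ^ i) d) ∈ orbitLabels σ label d := by
  classical
  exact Multiset.mem_map_of_mem _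
    (Finset.mem_filter.2 ⟨Finset.mem_univ _, Equiv.Perm.SameCycle.symm ⟨i, by simp⟩⟩)

theorem orbitLabels_eq {σ : Equiv.Perm D} (label : D → A) {d : D} {n : ℕ}
    (h : Function.minimalPeriod σ d = n) :
    orbitLabels σ label d = (Multiset.range n).map fun i => label ((σ ^ i) d) := by
  rw [orbitLabels_eq_of_minimalPeriod, h]

omit [Fintype D] in
theorem minimalPeriod_eq_of_prime {σ : Equiv.Perm D} {d : D} {n : ℕ} (hn : n.Prime)
    (h : (σ ^ n) d = d) (h1 : σ d ≠ d) : Function.minimalPeriod σ d = n := by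
  have : Fact n.Prime := ⟨hn⟩
  refine Function.minimalPeriod_eq_prime ?_ h1
  rw [Function.IsPeriodicPt, Equiv.Perm.iterate_eq_pow]
  exact h

end Orbits

/-! ### Invariance under isomorphisms and mirror images -/

section Invariance

variable {D D' A : Type*}

/-- The forward direction is induction over the group generated by `face` and `edge`; the converse
takes for `p` the orbit of `x`. In this form connectedness serves to propagate local properties over
the whole surface. -/
theorem OrientedMap.isConnected_iff {M : OrientedMap D} : M.IsConnected ↔
    ∀ p : D → Prop, (∀ x, p (M.face x) ↔ p x) → (∀ x, p (M.edge x) ↔ p x) →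
      ∀ x y, p x → p y := by
  constructor
  · intro h p hf he x y hx
    obtain ⟨g, hg, rfl⟩ := h x y
    have : ∀ z, p (g z) ↔ p z := by
      induction hg using Subgroup.closure_induction with
      | mem g hg =>
        rcases hg with rfl | hg
        · exact hf
        · rw [Set.mem_singleton_iff.1 hg]; exact he
      | one => simp
      | mul g g' _ _ h1 h2 => intro z; rw [Equiv.Perm.mul_apply, h1, h2]
      | inv g _ h1 =>
        intro z
        rw [← h1 (g⁻¹ z), ← Equiv.Perm.mul_apply, mul_inv_cancel, Equiv.Perm.one_apply]
    exact (this x).2 hx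
  · intro h x y
    have hinv : ∀ s ∈ ({M.face, M.edge} : Set (Equiv.Perm D)), ∀ z,
        (∃ g ∈ Subgroup.closure ({M.face, M.edge} : Set (Equiv.Perm D)), g x = s z) ↔
        ∃ g ∈ Subgroup.closure ({M.face, M.edge} : Set (Equiv.Perm D)), g x = z := by
      intro s hs z
      have hs := Subgroup.subset_closure hs
      constructor
      · rintro ⟨g, hg, hz⟩
        exact ⟨s⁻¹ * g, mul_mem (inv_mem hs) hg, by
          rw [Equiv.Perm.mul_apply, hz, ← Equiv.Perm.mul_apply, inv_mul_cancel,
            Equiv.Perm.one_apply]⟩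
      · rintro ⟨g, hg, rfl⟩
        exact ⟨s * g, mul_mem hs hg, rfl⟩
    exact h (fun z => ∃ g ∈ Subgroup.closure ({M.face, M.edge} : Set (Equiv.Perm D)), g x = z)
      (hinv _ (by simp)) (hinv _ (by simp)) x y ⟨1, one_mem _, rfl⟩

theorem sameCycle_equiv {σ : Equiv.Perm D} {σ' : Equiv.Perm D'} (f : D ≃ D')
    (h : ∀ d, f (σ d) = σ' (f d)) (x y : D) : σ.SameCycle x y ↔ σ'.SameCycle (f x) (f y) := by
  constructor
  · intro hxy
    exact (iff_of_sameCycle (p := fun z => σ'.SameCycle (f x) (f z))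
      (fun z => by rw [h, Equiv.Perm.sameCycle_apply_right]) hxy).1 (.refl _ _)
  · intro hxy
    have h' : ∀ d, f.symm (σ' d) = σ (f.symm d) := fun d => by
      rw [Equiv.symm_apply_eq, h, Equiv.apply_symm_apply]
    have := (iff_of_sameCycle (p := fun z => σ.SameCycle x (f.symm z))
      (fun z => by rw [h', Equiv.Perm.sameCycle_apply_right]) hxy).1
      (by rw [Equiv.symm_apply_apply])
    rwa [Equiv.symm_apply_apply] at this

theorem card_cycles_congr [Fintype D] [Fintype D'] {σ : Equiv.Perm D} {σ' : Equiv.Perm D'}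
    (e : D ≃ D') (h : ∀ x y, σ.SameCycle x y ↔ σ'.SameCycle (e x) (e y)) :
    Nat.card (Cycles σ) = Nat.card (Cycles σ') :=
  Nat.card_congr (Quotient.congr e h)

namespace LabelledMap

theorem Isomorphic.vertex {T : LabelledMap D A} {T' : LabelledMap D' A} {f : D ≃ D'}
    (hf : ∀ d, f (T.face d) = T'.face (f d)) (he : ∀ d, f (T.edge d) = T'.edge (f d)) (d : D) :
    f (T.vertex d) = T'.vertex (f d) := by
  simp only [OrientedMap.vertex, Equiv.Perm.mul_apply, hf, he]

theorem face_pow_equiv {T : LabelledMap D A} {T' : LabelledMap D' A} {f : D ≃ D'}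
    (hf : ∀ d, f (T.face d) = T'.face (f d)) (i : ℕ) (d : D) :
    f ((T.face ^ i) d) = (T'.face ^ i) (f d) := by
  induction i with
  | zero => rfl
  | succ i ih => rw [pow_succ', pow_succ', Equiv.Perm.mul_apply, Equiv.Perm.mul_apply, hf, ih]

theorem Isomorphic.isTilingFor [Fintype D] [Fintype D'] {T : LabelledMap D A}
    {T' : LabelledMap D' A} {V : AVC A} (h : T.Isomorphic T') (h' : T'.IsTilingFor V) :
    T.IsTilingFor V := by
  obtain ⟨f, hf, he, hl⟩ := h
  have hv := Isomorphic.vertex hf he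
  refine ⟨⟨?_, ?_⟩, ?_, ?_, ?_, ?_⟩
  · rw [OrientedMap.isConnected_iff]
    intro p h1 h2 x y hx
    have := OrientedMap.isConnected_iff.1 h'.sphere.1 (fun z => p (f.symm z))
      (fun z => by
        rw [← h1 (f.symm z)]; congr! 1; rw [Equiv.symm_apply_eq, hf, Equiv.apply_symm_apply])
      (fun z => by
        rw [← h2 (f.symm z)]; congr! 1; rw [Equiv.symm_apply_eq, he, Equiv.apply_symm_apply])
      (f x) (f y) (by simpa using hx)
    simpa using this
  · rw [card_cycles_congr f (sameCycle_equiv f hv), card_cycles_congr f (sameCycle_equiv f hf),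
      card_cycles_congr f (sameCycle_equiv f he)]
    exact h'.sphere.2
  · intro d
    obtain ⟨h1, h2⟩ := h'.pentagonal (f d)
    rw [← face_pow_equiv hf] at h1
    rw [← hf] at h2
    exact ⟨f.injective h1, fun h => h2 (by rw [h])⟩
  · obtain ⟨w, hw⟩ := h'.congruent
    refine ⟨w, fun d => ?_⟩
    obtain ⟨k, hk⟩ := hw (f d)
    exact ⟨k, by simpa only [← face_pow_equiv hf, hl] using hk⟩
  · rw [← h'.tiles]
    exact cycleLabels_congr f (sameCycle_equiv f hf) hl
  · rw [← h'.vertices]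
    exact cycleLabels_congr f (sameCycle_equiv f hv) hl

theorem vertex_mirror (T : LabelledMap D A) : T.mirror.vertex = T.vertex⁻¹ := by
  simp only [OrientedMap.vertex, mirror, mul_inv_rev]
  have : T.edge⁻¹ = T.edge := by
    ext d; rw [Equiv.Perm.inv_eq_iff_eq, T.edge_edge]
  rw [this]; group

theorem mirror_mirror (T : LabelledMap D A) : T.mirror.mirror = T := by
  have : T.face⁻¹ * (T.face * T.edge * T.face⁻¹) * T.face⁻¹⁻¹ = T.edge := by group
  obtain ⟨⟨face, edge, h1, h2⟩, label⟩ := T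
  simp only [mirror, LabelledMap.mk.injEq, OrientedMap.mk.injEq, inv_inv, and_true, true_and]
  simpa using this

theorem Isomorphic.mirror {T : LabelledMap D A} {T' : LabelledMap D' A}
    (h : T.Isomorphic T') : T.mirror.Isomorphic T'.mirror := by
  obtain ⟨f, hf, he, hl⟩ := h
  have h1 : ∀ d, f (T.face⁻¹ d) = T'.face⁻¹ (f d) := fun d => by
    rw [Equiv.Perm.eq_inv_iff_eq, ← hf, ← Equiv.Perm.mul_apply, mul_inv_cancel,
      Equiv.Perm.one_apply]
  exact ⟨f, h1, fun d => by simp only [LabelledMap.mirror, Equiv.Perm.mul_apply, hf, he, h1], hl⟩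

theorem pow_five_inv {σ : Equiv.Perm D} {d : D} (h : ∀ d, (σ ^ 5) d = d) (i : ℕ) :
    (σ⁻¹ ^ i) d = (σ ^ (4 * i)) d := by
  have h5 : σ ^ 5 = 1 := Equiv.ext h
  have : σ⁻¹ = σ ^ 4 := by
    rw [inv_eq_iff_mul_eq_one, ← pow_succ', h5]
  rw [this, pow_mul]

/-- The mirror image inverts the rotations of tiles and vertices and conjugates that of edges, so
the cycles keep their labels. The cyclic word is read backwards, since `face⁻¹ = face ^ 4` and 4 =
-1 modulo 5. -/
theorem IsTilingFor.mirror [Fintype D] {T : LabelledMap D A} {V : AVC A} (h : T.IsTilingFor V) :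
    T.mirror.IsTilingFor V := by
  refine ⟨⟨?_, ?_⟩, ?_, ?_, ?_, ?_⟩
  · rw [OrientedMap.isConnected_iff]
    intro p h1 h2 x y hx
    have h3 : ∀ x, p (T.face x) ↔ p x := fun x => by
      rw [← h1 (T.face x)]; simp [LabelledMap.mirror]
    refine OrientedMap.isConnected_iff.1 h.sphere.1 p h3 (fun z => ?_) x y hx
    rw [← h3 z, ← h2 (T.face z), ← h3 (T.edge z)]
    simp [LabelledMap.mirror]
  · rw [vertex_mirror,
      ← card_cycles_congr (σ' := T.vertex⁻¹) (Equiv.refl D) (σ := T.vertex) (by simp),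
      ← card_cycles_congr (σ' := T.mirror.face) (Equiv.refl D) (σ := T.face)
        (by simp [LabelledMap.mirror]),
      -- The edge involution of the mirror image is the conjugate by `face`, so here the bijection
      -- of darts is `face` instead of the identity.
      ← card_cycles_congr (σ' := T.mirror.edge) T.face (σ := T.edge)
        (sameCycle_equiv _ (by simp [LabelledMap.mirror]))]
    exact h.sphere.2
  · intro d
    have h5 := fun d => (h.pentagonal d).1
    refine ⟨?_, fun h1 => (h.pentagonal d).2 ?_⟩
    · change (T.face⁻¹ ^ 5) d = d
      rw [inv_pow, show T.face ^ 5 = 1 from Equiv.ext h5, inv_one, Equiv.Perm.one_apply]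
    · exact (Equiv.Perm.inv_eq_iff_eq.1 h1).symm
  · obtain ⟨w, hw⟩ := h.congruent
    have h5 := fun d => (h.pentagonal d).1
    have h4 : (4 : ZMod 5) = -1 := by decide
    refine ⟨w, fun d => ?_⟩
    obtain ⟨k, hk | hk⟩ := hw d
    · refine ⟨k, Or.inr fun i => ?_⟩
      change T.label ((T.face⁻¹ ^ i) d) = _
      rw [pow_five_inv h5, hk]; push_cast; rw [h4]; congr 1; ring
    · refine ⟨k, Or.inl fun i => ?_⟩
      change T.label ((T.face⁻¹ ^ i) d) = _
      rw [pow_five_inv h5, hk]; push_cast; rw [h4]; congr 1; ring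
  · rw [← h.tiles]
    exact (cycleLabels_congr (Equiv.refl D) (by simp [LabelledMap.mirror])
      (by simp [LabelledMap.mirror])).symm
  · rw [← h.vertices, vertex_mirror]
    exact (cycleLabels_congr (Equiv.refl D) (by simp) (by simp [LabelledMap.mirror])).symm

theorem Equivalent.isTilingFor [Fintype D] [Fintype D'] {T : LabelledMap D A}
    {T' : LabelledMap D' A} {V : AVC A} (h : T.Equivalent T') (h' : T'.IsTilingFor V) :
    T.IsTilingFor V :=
  h.elim (fun h => h.isTilingFor h') fun h => h.isTilingFor h'.mirror

theorem Isomorphic.trans {D'' : Type*} {T : LabelledMap D A} {T' : LabelledMap D' A}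
    {T'' : LabelledMap D'' A} (h : T.Isomorphic T') (h' : T'.Isomorphic T'') :
    T.Isomorphic T'' := by
  obtain ⟨f, h1, h2, h3⟩ := h
  obtain ⟨g, h1', h2', h3'⟩ := h'
  exact ⟨f.trans g, fun d => by simp [h1, h1'], fun d => by simp [h2, h2'],
    fun d => by simp [h3, h3']⟩

theorem Isomorphic.symm {T : LabelledMap D A} {T' : LabelledMap D' A} (h : T.Isomorphic T') :
    T'.Isomorphic T := by
  obtain ⟨f, h1, h2, h3⟩ := h
  exact ⟨f.symm, fun d => by rw [Equiv.symm_apply_eq, h1, Equiv.apply_symm_apply],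
    fun d => by rw [Equiv.symm_apply_eq, h2, Equiv.apply_symm_apply],
    fun d => by rw [← h3, Equiv.apply_symm_apply]⟩

end LabelledMap

end Invariance

/-! ### Local description of the tilings -/

/-- The AVC `{a α²β²γ : a α²β, b β³, c γᵏ}`. -/
def avc (k a b c : ℕ) : AVC Label3 where
  numTiles := a
  tile := {.α, .α, .β, .β, .γ}
  vertices := Multiset.replicate a {.α, .α, .β} + Multiset.replicate b {.β, .β, .β} +
    Multiset.replicate c (Multiset.replicate k .γ)

theorem avc_24 : AVC3D24 = avc 4 24 8 6 := rfl

theorem avc_60 : AVC3D60 = avc 5 60 20 12 := rfl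

/-- The conditions on a tiling for an AVC of the form `{a α²β²γ : a α²β, b β³, c γᵏ}`, apart from
the numbers of tiles and vertices. -/
structure LabelledMap.IsLocalTiling {D : Type*} [Fintype D] (T : LabelledMap D Label3) (k : ℕ) :
    Prop where
  connected : T.IsConnected
  pentagonal : T.IsPentagonal
  congruent : T.IsCornerCongruent
  tile : ∀ d, orbitLabels T.face T.label d = {.α, .α, .β, .β, .γ}
  vertex : ∀ d, orbitLabels T.vertex T.label d = {.α, .α, .β} ∨
    orbitLabels T.vertex T.label d = {.β, .β, .β} ∨
    orbitLabels T.vertex T.label d = Multiset.replicate k .γ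

theorem multiset_eq_of_three {A : Type*} {a b c : A} {s : Multiset A}
    (h : ∀ x ∈ s, x = a ∨ x = b ∨ x = c) :
    ∃ i j k, s = Multiset.replicate i a + Multiset.replicate j b + Multiset.replicate k c := by
  induction s using Multiset.induction_on with
  | empty => exact ⟨0, 0, 0, by simp⟩
  | cons x s ih =>
    obtain ⟨i, j, k, rfl⟩ := ih fun y hy => h y (Multiset.mem_cons_of_mem hy)
    rcases h x (Multiset.mem_cons_self _ _) with rfl | rfl | rfl
    · exact ⟨i + 1, j, k, by simp [Multiset.replicate_succ]⟩
    · exact ⟨i, j + 1, k, by simp [Multiset.replicate_succ]⟩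
    · exact ⟨i, j, k + 1, by simp [Multiset.replicate_succ]⟩

section Local

variable {D : Type*} [Fintype D] {T : LabelledMap D Label3} {k a b c : ℕ}

theorem LabelledMap.IsTilingFor.isLocalTiling (h : T.IsTilingFor (avc k a b c)) :
    T.IsLocalTiling k where
  connected := h.sphere.1
  pentagonal := h.pentagonal
  congruent := h.congruent
  tile d := by
    have : orbitLabels T.face T.label d ∈ cycleLabels T.face T.label := mem_cycleLabels.2 ⟨d, rfl⟩
    rw [h.tiles] at this
    exact Multiset.eq_of_mem_replicate this
  vertex d := by
    have : orbitLabels T.vertex T.label d ∈ cycleLabels T.vertex T.label :=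
      mem_cycleLabels.2 ⟨d, rfl⟩
    rw [h.vertices] at this
    simp only [avc, Multiset.mem_add] at this
    rcases this with (h | h) | h
    · exact Or.inl (Multiset.eq_of_mem_replicate h)
    · exact Or.inr (Or.inl (Multiset.eq_of_mem_replicate h))
    · exact Or.inr (Or.inr (Multiset.eq_of_mem_replicate h))

theorem LabelledMap.IsTilingFor.card_eq (h : T.IsTilingFor (avc k a b c)) :
    Fintype.card D = 5 * a := by
  have := congr_arg Multiset.card (sum_cycleLabels T.face T.label)
  rw [h.tiles] at this
  simpa [avc, mul_comm] using this.symm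

/-- Counting darts gives the number of tiles. If i, j, l are the numbers of vertices α²β, β³, γᵏ,
counting α, β, γ over tiles and over vertices gives 2i = 2a, i + 3j = 2a, kl = a. With 5a/2 edges,
`hE` is twice Euler's formula. -/
theorem LabelledMap.IsLocalTiling.isTilingFor (h : T.IsLocalTiling k) (hD : Fintype.card D = 5 * a)
    (hk : k ≠ 0) (hb : 3 * b = a) (hc : k * c = a) (hE : 4 * a + 2 * b + 2 * c = 5 * a + 4) :
    T.IsTilingFor (avc k a b c) := by
  have htiles : cycleLabels T.face T.label = Multiset.replicate a {.α, .α, .β, .β, .γ} := by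
    have h1 : ∀ m ∈ cycleLabels T.face T.label, m = {.α, .α, .β, .β, .γ} := by
      intro m hm
      obtain ⟨d, rfl⟩ := mem_cycleLabels.1 hm
      exact h.tile d
    have h2 := Multiset.eq_replicate_card.2 h1
    have h3 := congr_arg Multiset.card (sum_cycleLabels T.face T.label)
    rw [h2] at h3 ⊢
    simp only [Multiset.sum_replicate, Multiset.card_nsmul, Multiset.card_map, Finset.card_val,
      Finset.card_univ, hD] at h3
    congr 1
    simp only [Multiset.insert_eq_cons, Multiset.card_cons, Multiset.card_singleton] at h3
    simp at h3
    omega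
  have hvert : cycleLabels T.vertex T.label = (avc k a b c).vertices := by
    obtain ⟨i, j, l, hijl⟩ := multiset_eq_of_three (s := cycleLabels T.vertex T.label)
      (a := {.α, .α, .β}) (b := {.β, .β, .β}) (c := Multiset.replicate k .γ) (by
        intro m hm
        obtain ⟨d, rfl⟩ := mem_cycleLabels.1 hm
        exact h.vertex d)
    have h3 := (sum_cycleLabels T.vertex T.label).trans (sum_cycleLabels T.face T.label).symm
    rw [hijl, htiles] at h3
    simp only [Multiset.sum_add, Multiset.sum_replicate] at h3
    have hα := congr_arg (Multiset.count .α) h3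
    have hβ := congr_arg (Multiset.count .β) h3
    have hγ := congr_arg (Multiset.count .γ) h3
    simp [Multiset.count_replicate, Multiset.count_nsmul] at hα hβ hγ
    have hl : l = c := by
      apply Nat.eq_of_mul_eq_mul_left (Nat.pos_of_ne_zero hk)
      rw [hc, mul_comm]; exact hγ
    have hi : i = a := by omega
    have hj : j = b := by omega
    rw [hijl, hi, hj, hl]
    rfl
  have hedge : 2 * Nat.card (Cycles T.edge) = 5 * a := by
    -- Constant labels turn the sum of the labels over all cycles into a count of darts; every edge
    -- has two.
    have h1 : ∀ m ∈ cycleLabels T.edge (fun _ => ()), m = Multiset.replicate 2 () := by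
      intro m hm
      obtain ⟨d, rfl⟩ := mem_cycleLabels.1 hm
      rw [Multiset.eq_replicate, card_orbitLabels]
      exact ⟨minimalPeriod_eq_of_prime Nat.prime_two (by simp [pow_two, T.edge_edge])
        (T.edge_ne d), fun _ _ => rfl⟩
    have h3 := congr_arg Multiset.card (sum_cycleLabels T.edge fun _ => ())
    rw [Multiset.eq_replicate_card.2 h1, card_cycleLabels] at h3
    simp [hD] at h3
    omega
  refine ⟨⟨h.connected, ?_⟩, h.pentagonal, h.congruent, htiles, hvert⟩
  rw [← card_cycleLabels T.vertex T.label, ← card_cycleLabels T.face T.label, htiles, hvert]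
  simp [avc]
  omega

end Local

/-! ### Labelled pentagonal subdivisions -/

section Subdivision

variable {G : Type*}

/-- The pentagonal subdivision of `M` with the given labels of its corners. -/
def labelledSubdivision (M : OrientedMap G) (l : G × Label5 → Label3) :
    LabelledMap (G × Label5) Label3 where
  toOrientedMap := (pentSubdivision M).toOrientedMap
  label := l

/-- The labels obtained from `r` by exchanging `α` and `β` in the tiles `d` with `x d`. -/
def flipLabel (r : Label5 → Label3) (x : G → Bool) (d : G × Label5) : Label3 :=
  if x d.1 then swapAB (r d.2) else r d.2

/-- Flipping the tiles in `x` changes an even number of corners at every vertex of degree three of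
the pentagonal subdivision of `M`. -/
structure IsFlip (M : OrientedMap G) (x : G → Bool) : Prop where
  edge : ∀ d, x (M.edge d) = (x d ^^ x (M.face d))
  vertex : ∀ d, (x d ^^ (x (M.vertex d) ^^ x (M.vertex (M.vertex d)))) = false

theorem isFlip_false (M : OrientedMap G) : IsFlip M fun _ => false := ⟨by simp, by simp⟩

variable (M : OrientedMap G)

theorem face_subdivision (d : G) (c : Label5) :
    (pentSubdivision M).face (d, c) = (d, nextCorner c) := rfl

theorem vertex_subdivision_ε (d : G) :
    (pentSubdivision M).vertex (d, .ε) = (M.face⁻¹ d, .ε) := rfl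

theorem vertex_subdivision_α (d : G) :
    (pentSubdivision M).vertex (d, .α) = (M.edge (M.face⁻¹ d), .β) := rfl

theorem vertex_subdivision_β (d : G) : (pentSubdivision M).vertex (d, .β) = (M.edge d, .γ) := rfl

theorem vertex_subdivision_γ (d : G) : (pentSubdivision M).vertex (d, .γ) = (M.face d, .α) := rfl

theorem vertex_subdivision_δ (d : G) : (pentSubdivision M).vertex (d, .δ) = (M.vertex d, .δ) := rfl

theorem isConnected_subdivision (h : M.IsConnected) :
    (pentSubdivision M).IsConnected := by
  rw [OrientedMap.isConnected_iff] at h ⊢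
  intro p hf he
  have h0 : ∀ d c, p (d, c) ↔ p (d, .ε) := by
    intro d c
    have h1 := fun c => hf (d, c)
    simp only [face_subdivision] at h1
    have hε := h1 .ε
    have hα := h1 .α
    have hδ := h1 .δ
    have hβ := h1 .β
    simp only [nextCorner, Equiv.coe_fn_mk] at hε hα hδ hβ
    cases c <;> tauto
  have h1 : ∀ d, p (M.face d, .ε) ↔ p (d, .ε) := fun d => by
    rw [← h0 d .γ]; exact he (d, .γ)
  have h2 : ∀ d, p (M.edge d, .ε) ↔ p (d, .ε) := fun d => by
    rw [← h0 d .β, ← h0 _ .β]; exact he (d, .β)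
  rintro ⟨x, c⟩ ⟨y, c'⟩ hx
  rw [h0] at hx ⊢
  exact h (fun d => p (d, .ε)) h1 h2 x y hx

variable {M} {l : G × Label5 → Label3}

theorem subdivision_face_pow (d : G) (c : Label5) (i : ℕ) :
    ((labelledSubdivision M l).face ^ i) (d, c) = (d, (nextCorner ^ i) c) := by
  induction i with
  | zero => rfl
  | succ i ih => rw [pow_succ', Equiv.Perm.mul_apply, ih, pow_succ', Equiv.Perm.mul_apply]; rfl

theorem nextCorner_pow_five (c : Label5) : (nextCorner ^ 5) c = c := by
  cases c <;> rfl

theorem isPentagonal_subdivision : (labelledSubdivision M l).IsPentagonal := by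
  rintro ⟨d, c⟩
  refine ⟨by rw [subdivision_face_pow, nextCorner_pow_five], fun h => ?_⟩
  have h2 : nextCorner c = c := congr_arg Prod.snd h
  cases c <;> cases h2

/-- The position of a corner of the pentagon, starting from `ε`. -/
def cornerIndex : Label5 → ZMod 5
  | .ε => 0 | .α => 1 | .δ => 2 | .β => 3 | .γ => 4

/-- The corner of the pentagon at the given position. -/
def cornerAt : ZMod 5 → Label5 := (![.ε, .α, .δ, .β, .γ] : Fin 5 → Label5)

theorem cornerIndex_pow (c : Label5) (i : ℕ) :
    cornerIndex ((nextCorner ^ i) c) = cornerIndex c + i := by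
  induction i with
  | zero => simp
  | succ i ih =>
    have h : ∀ c, cornerIndex (nextCorner c) = cornerIndex c + 1 := by decide
    rw [pow_succ', Equiv.Perm.mul_apply, h, ih]; push_cast; ring

theorem cornerAt_cornerIndex : ∀ c, cornerAt (cornerIndex c) = c := by decide

/-- Negating `cornerIndex` reflects the pentagon in the axis through ε. If this reflection has the
effect of `swapAB` on the labels, a tile with α and β exchanged reads the same word backwards. -/
theorem isCornerCongruent_subdivision {r : Label5 → Label3} {x : G → Bool}
    (h : ∀ c, r (cornerAt (-cornerIndex c)) = swapAB (r c) ∨ ∀ d, x d = false) :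
    (labelledSubdivision M (flipLabel r x)).IsCornerCongruent := by
  refine ⟨fun i => r (cornerAt i), ?_⟩
  rintro ⟨d, c⟩
  simp only [subdivision_face_pow]
  cases hx : x d
  · refine ⟨cornerIndex c, Or.inl fun i => ?_⟩
    rw [← cornerIndex_pow, cornerAt_cornerIndex]
    simp [labelledSubdivision, flipLabel, hx]
  · refine ⟨-cornerIndex c, Or.inr fun i => ?_⟩
    rw [← neg_add', ← cornerIndex_pow, (h _).resolve_right fun h => by simp [h] at hx]
    simp [labelledSubdivision, flipLabel, hx]

/-- Rotation around the centre of a face is `M.face⁻¹`, which has the same periods as `M.face`. -/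
theorem minimalPeriod_subdivision_ε [Finite G] (d : G) :
    Function.minimalPeriod (labelledSubdivision M l).vertex (d, .ε) =
      Function.minimalPeriod M.face d := by
  rw [Function.minimalPeriod_eq_minimalPeriod_iff]
  intro n
  have h : ∀ n, ((labelledSubdivision M l).vertex ^ n) (d, .ε) = ((M.face⁻¹ ^ n) d, .ε) := by
    intro n
    induction n with
    | zero => rfl
    | succ n ih => rw [pow_succ', Equiv.Perm.mul_apply, ih, pow_succ', Equiv.Perm.mul_apply]; rfl
  rw [Function.IsPeriodicPt, Function.IsPeriodicPt, Function.IsFixedPt, Function.IsFixedPt,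
    Equiv.Perm.iterate_eq_pow, Equiv.Perm.iterate_eq_pow, h, inv_pow, Prod.mk.injEq,
    Equiv.Perm.inv_eq_iff_eq]
  simp [eq_comm]

theorem orbitLabels_three {D A : Type*} [Fintype D] {σ : Equiv.Perm D} {label : D → A} {a b c : D}
    (h1 : σ a = b) (h2 : σ b = c) (h3 : σ c = a) (h : a ≠ b) :
    orbitLabels σ label a = {label a, label b, label c} := by
  rw [orbitLabels_eq label (minimalPeriod_eq_of_prime Nat.prime_three ?_ ?_)]
  · simp only [Multiset.range_succ, Multiset.range_zero, Multiset.map_cons, Multiset.map_zero,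
      pow_succ', pow_zero, Equiv.Perm.mul_apply, Equiv.Perm.one_apply, h1, h2]
    simp only [Multiset.insert_eq_cons, ← Multiset.singleton_add, add_zero]
    abel
  · simp only [pow_succ', pow_zero, Equiv.Perm.mul_apply, Equiv.Perm.one_apply, h1, h2, h3]
  · rw [h1]; exact h.symm

/-- A subdivision has three kinds of vertices: new vertices on edges with corners α, β, γ, old
vertices with three corners δ, and face centres. Without flips they carry α²β, β³ and γᵏ. Exchanging
α and β at an even number of the three corners of a vertex of degree three turns α²β and β³ into one
of these two again. -/
theorem isLocalTiling_subdivision [Fintype G] {r : Label5 → Label3} {x : G → Bool} {k : ℕ}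
    (hM : M.IsConnected) (hf : ∀ d, Function.minimalPeriod M.face d = k)
    (hv : ∀ d, Function.minimalPeriod M.vertex d = 3) (hx : IsFlip M x)
    (hr : r = red3D1 ∨ r = red3D3 ∨ r = red3D2 ∧ ∀ d, x d = false) :
    (labelledSubdivision M (flipLabel r x)).IsLocalTiling k where
  connected := isConnected_subdivision M hM
  pentagonal := isPentagonal_subdivision
  congruent := by
    apply isCornerCongruent_subdivision
    rcases hr with rfl | rfl | ⟨-, h⟩
    · exact fun c => Or.inl (by revert c; decide)
    · exact fun c => Or.inl (by revert c; decide)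
    · exact fun _ => Or.inr h
  tile := by
    rintro ⟨d, c⟩
    obtain ⟨h1, h2⟩ := isPentagonal_subdivision (M := M) (l := flipLabel r x) (d, c)
    rw [orbitLabels_eq _ (minimalPeriod_eq_of_prime Nat.prime_five h1 h2)]
    simp only [subdivision_face_pow]
    change Multiset.map (fun i => if x d then swapAB (r ((nextCorner ^ i) c))
      else r ((nextCorner ^ i) c)) (Multiset.range 5) = _
    have hd : x d = false ∨ r ≠ red3D2 := by
      rcases hr with rfl | rfl | ⟨rfl, h⟩
      · exact Or.inr (by decide)
      · exact Or.inr (by decide)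
      · exact Or.inl (h d)
    have hr : r = red3D1 ∨ r = red3D2 ∨ r = red3D3 := by tauto
    clear hx h1 h2
    generalize x d = b at hd ⊢
    rcases hr with rfl | rfl | rfl <;> revert b c <;> decide
  vertex := by
    have hX : ∀ d, ({flipLabel r x (M.face d, .α), flipLabel r x (M.edge d, .β),
        flipLabel r x (d, .γ)} : Multiset Label3) = {.α, .α, .β} ∨
        ({flipLabel r x (M.face d, .α), flipLabel r x (M.edge d, .β),
        flipLabel r x (d, .γ)} : Multiset Label3) = {.β, .β, .β} := by
      intro d
      have h1 := hx.edge d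
      simp only [flipLabel]
      rcases hr with rfl | rfl | ⟨rfl, h⟩
      · generalize x (M.edge d) = b1, x d = b2, x (M.face d) = b3 at *
        revert b1 b2 b3; decide
      · generalize x (M.edge d) = b1, x d = b2, x (M.face d) = b3 at *
        revert b1 b2 b3; decide
      · rw [h, h, h]; decide
    have hV : ∀ d, ({flipLabel r x (d, .δ), flipLabel r x (M.vertex d, .δ),
        flipLabel r x (M.vertex (M.vertex d), .δ)} : Multiset Label3) = {.α, .α, .β} ∨
        ({flipLabel r x (d, .δ), flipLabel r x (M.vertex d, .δ),
        flipLabel r x (M.vertex (M.vertex d), .δ)} : Multiset Label3) = {.β, .β, .β} := by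
      intro d
      have h1 := hx.vertex d
      simp only [flipLabel]
      rcases hr with rfl | rfl | ⟨rfl, h⟩
      · generalize x d = b1, x (M.vertex d) = b2, x (M.vertex (M.vertex d)) = b3 at *
        revert b1 b2 b3; decide
      · generalize x d = b1, x (M.vertex d) = b2, x (M.vertex (M.vertex d)) = b3 at *
        revert b1 b2 b3; decide
      · rw [h, h, h]; decide
    -- A new vertex on an edge may be entered at its corner α, β or γ; rotating the multiset reduces
    -- all cases to `hX`.
    have rot : ∀ a b c : Label3, ({a, b, c} : Multiset Label3) = {b, c, a} := by decide
    rintro ⟨d, c⟩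
    cases c
    · obtain ⟨d, rfl⟩ := M.face.surjective d
      rw [← or_assoc]; left
      rw [orbitLabels_three (σ := (labelledSubdivision M (flipLabel r x)).vertex)
        (a := (M.face d, .α)) (b := (M.edge d, .β)) (c := (d, .γ))
        (congr_arg (fun e => (M.edge e, Label5.β)) (M.face.symm_apply_apply d))
        (congr_arg (fun e => (e, Label5.γ)) (M.edge_edge d)) rfl (by simp)]
      exact hX d
    · obtain ⟨d, rfl⟩ := M.edge.surjective d
      rw [← or_assoc]; left
      rw [orbitLabels_three (σ := (labelledSubdivision M (flipLabel r x)).vertex)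
        (b := (d, .γ)) (c := (M.face d, .α))
        (congr_arg (fun e => (e, Label5.γ)) (M.edge_edge d)) rfl
        (congr_arg (fun e => (M.edge e, Label5.β)) (M.face.symm_apply_apply d)) (by simp)]
      rw [← rot]
      exact hX d
    · rw [← or_assoc]; left
      rw [orbitLabels_three (σ := (labelledSubdivision M (flipLabel r x)).vertex)
        (b := (M.face d, .α)) (c := (M.edge d, .β)) rfl
        (congr_arg (fun e => (M.edge e, Label5.β)) (M.face.symm_apply_apply d))
        (congr_arg (fun e => (e, Label5.γ)) (M.edge_edge d)) (by simp)]
      rw [rot]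
      exact hX d
    · rw [← or_assoc]; left
      have h3 : M.vertex (M.vertex (M.vertex d)) = d := by
        have := Function.iterate_minimalPeriod (f := M.vertex) (x := d)
        rwa [hv] at this
      have h1 : d ≠ M.vertex d := fun h => by
        have := Function.minimalPeriod_eq_one_iff_isFixedPt.2 h.symm
        rw [hv] at this
        cases this
      rw [orbitLabels_three (σ := (labelledSubdivision M (flipLabel r x)).vertex)
        (b := (M.vertex d, .δ)) (c := (M.vertex (M.vertex d), .δ)) rfl rfl
        (congr_arg (fun e => (e, Label5.δ)) h3) (by simpa using h1)]
      exact hV d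
    · right; right
      rw [Multiset.eq_replicate, card_orbitLabels, minimalPeriod_subdivision_ε, hf]
      refine ⟨rfl, fun b hb => ?_⟩
      obtain ⟨⟨e, c⟩, he, rfl⟩ := Multiset.mem_map.1 hb
      have hc : c = .ε := by
        simp only [Finset.mem_val, Finset.mem_filter, Finset.mem_univ, true_and] at he
        refine (iff_of_sameCycle (p := fun y : G × Label5 => y.2 = .ε) ?_ he).2 rfl
        rintro ⟨d, c⟩
        cases c <;> simp [labelledSubdivision, vertex_subdivision_ε, vertex_subdivision_α,
          vertex_subdivision_β, vertex_subdivision_γ, vertex_subdivision_δ]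
      subst hc
      simp only [labelledSubdivision, flipLabel]
      rcases hr with rfl | rfl | ⟨rfl, -⟩ <;> split_ifs <;> rfl

end Subdivision

/-! ### The tilings are labelled pentagonal subdivisions -/

universe u

section Standard

namespace LabelledMap

theorem eq_of_face_edge_label {D A : Type*} {T T' : LabelledMap D A} (hf : T.face = T'.face)
    (he : T.edge = T'.edge) (hl : T.label = T'.label) : T = T' := by
  obtain ⟨⟨face, edge, _, _⟩, label⟩ := T
  obtain ⟨⟨face', edge', _, _⟩, label'⟩ := T'
  simp only at hf he hl
  subst hf he hl
  rfl

/-- The same labelled map with renamed darts. -/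
def transport {D D' A : Type*} (T : LabelledMap D A) (e : D ≃ D') : LabelledMap D' A where
  face := e.permCongr T.face
  edge := e.permCongr T.edge
  edge_edge d := by simp [Equiv.permCongr_apply, T.edge_edge]
  edge_ne d h := T.edge_ne (e.symm d) (e.injective (by simpa [Equiv.permCongr_apply] using h))
  label := T.label ∘ e.symm

theorem isomorphic_transport {D D' A : Type*} (T : LabelledMap D A) (e : D ≃ D') :
    T.Isomorphic (T.transport e) :=
  ⟨e, fun d => by simp [transport, Equiv.permCongr_apply],
    fun d => by simp [transport, Equiv.permCongr_apply], fun d => by simp [transport]⟩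

/-- The darts of the map are given by a tile and a corner of the tile, and `ε` is the corner
with label `γ`. -/
structure IsStandard {G : Type*} (T : LabelledMap (G × Label5) Label3) : Prop where
  face_apply : ∀ d c, T.face (d, c) = (d, nextCorner c)
  label_eq : ∀ d c, T.label (d, c) = .γ ↔ c = .ε

/-! ### Naming corners from the unique corner γ of each tile -/

theorem IsLocalTiling.map_label_face {D : Type*} [Fintype D] {T : LabelledMap D Label3} {k : ℕ}
    (h : T.IsLocalTiling k) (d : D) :
    (Multiset.range 5).map (fun i => T.label ((T.face ^ i) d)) = {.α, .α, .β, .β, .γ} := by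
  rw [← h.tile d, orbitLabels_eq _ (minimalPeriod_eq_of_prime Nat.prime_five
    (h.pentagonal d).1 (h.pentagonal d).2)]

theorem label_ne_γ_of_tile : ∀ a b c d : Label3,
    ({a, b, c, d, .γ} : Multiset Label3) = {.α, .α, .β, .β, .γ} →
    a ≠ .γ ∧ b ≠ .γ ∧ c ≠ .γ ∧ d ≠ .γ := by
  decide

theorem IsLocalTiling.label_ne {D : Type*} [Fintype D] {T : LabelledMap D Label3} {k : ℕ}
    (h : T.IsLocalTiling k) {d : D} (hd : T.label d = .γ) {i : ℕ} (hi : i < 5) (h0 : i ≠ 0) :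
    T.label ((T.face ^ i) d) ≠ .γ := by
  have h1 := h.map_label_face d
  simp only [Multiset.range_succ, Multiset.range_zero, Multiset.map_cons, Multiset.map_zero,
    pow_zero, Equiv.Perm.one_apply, hd] at h1
  obtain ⟨h4, h3, h2, h1⟩ := label_ne_γ_of_tile _ _ _ _ h1
  interval_cases i <;> first | contradiction | assumption

/-- The number of steps from `ε` to a corner. -/
def cornerSteps : Label5 → ℕ
  | .ε => 0 | .α => 1 | .δ => 2 | .β => 3 | .γ => 4

/-- The corners labelled γ index the tiles, and every dart is reached from the γ of its tile in a
unique number of steps below five. -/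
theorem IsLocalTiling.exists_isStandard {D : Type u} [Fintype D] {T : LabelledMap D Label3}
    {k : ℕ} (h : T.IsLocalTiling k) :
    ∃ (G : Type u) (_ : Fintype G) (T' : LabelledMap (G × Label5) Label3),
      T.Isomorphic T' ∧ T'.IsStandard := by
  classical
  let G := {d : D // T.label d = .γ}
  let ψ : G × Label5 → D := fun x => (T.face ^ cornerSteps x.2) x.1.1
  have h5 : ∀ n d, (T.face ^ (n + 5)) d = (T.face ^ n) d := fun n d => by
    rw [pow_add, Equiv.Perm.mul_apply, (h.pentagonal d).1]
  have hlt : ∀ c, cornerSteps c < 5 := by decide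
  have hinj : Function.Injective ψ := by
    have key : ∀ (g g' : G) (i j : ℕ), i < 5 → j ≤ i →
        (T.face ^ i) g.1 = (T.face ^ j) g'.1 → i = j ∧ g = g' := by
      intro g g' i j hi hij hgg
      obtain ⟨m, rfl⟩ := Nat.exists_eq_add_of_le hij
      rw [pow_add, Equiv.Perm.mul_apply] at hgg
      have hm := (T.face ^ j).injective hgg
      have h0 : m = 0 := by
        by_contra h0
        exact h.label_ne g.2 (by omega) h0 (hm ▸ g'.2)
      subst h0
      exact ⟨by simp, Subtype.ext hm⟩
    rintro ⟨g, c⟩ ⟨g', c'⟩ hgg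
    have hc : cornerSteps c = cornerSteps c' ∧ g = g' := by
      rcases le_total (cornerSteps c') (cornerSteps c) with hle | hle
      · exact key g g' _ _ (hlt _) hle hgg
      · obtain ⟨h1, h2⟩ := key g' g _ _ (hlt _) hle hgg.symm
        exact ⟨h1.symm, h2.symm⟩
    have hci : ∀ c c', cornerSteps c = cornerSteps c' → c = c' := by decide
    rw [hc.2, hci _ _ hc.1]
  have hsurj : Function.Surjective ψ := by
    intro d
    have hm : Label3.γ ∈ (Multiset.range 5).map fun i => T.label ((T.face ^ i) d) := by
      rw [h.map_label_face d]; decide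
    obtain ⟨i, hi, hid⟩ := Multiset.mem_map.1 hm
    rw [Multiset.mem_range] at hi
    -- If γ lies i steps ahead, the dart lies 5 - i steps behind it around the tile; i = 0 is
    -- separate because step numbers stay below five.
    have hex : ∀ i < 5, ∃ c, cornerSteps c + i = 5 ∨ cornerSteps c + i = 0 := by decide
    obtain ⟨c, hc⟩ := hex i hi
    refine ⟨(⟨(T.face ^ i) d, hid⟩, c), ?_⟩
    change (T.face ^ cornerSteps c) ((T.face ^ i) d) = d
    rw [← Equiv.Perm.mul_apply, ← pow_add]
    rcases hc with hc | hc <;> rw [hc]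
    · exact (h.pentagonal d).1
    · rfl
  let e : G × Label5 ≃ D := Equiv.ofBijective ψ ⟨hinj, hsurj⟩
  refine ⟨G, inferInstance, T.transport e.symm, T.isomorphic_transport _, ?_, ?_⟩
  · intro d c
    change e.symm (T.face (e (d, c))) = _
    rw [Equiv.symm_apply_eq]
    change T.face ((T.face ^ cornerSteps c) d.1) = (T.face ^ cornerSteps (nextCorner c)) d.1
    rw [← Equiv.Perm.mul_apply, ← pow_succ']
    cases c <;> first | rfl | exact h5 0 d.1
  · intro d c
    change T.label ((T.face ^ cornerSteps c) d.1) = .γ ↔ _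
    constructor
    · intro hc
      by_contra hne
      have h0 : ∀ c, cornerSteps c = 0 → c = .ε := by decide
      exact h.label_ne d.2 (hlt c) (fun hc => hne (h0 c hc)) hc
    · rintro rfl
      exact d.2

/-- Around the far end of the edge `γε` of the tile `d`, the third tile has its corner `β`, as in the
pentagonal subdivision. -/
def IsRegularAt {G : Type*} (T : LabelledMap (G × Label5) Label3) (d : G) : Prop :=
  ∃ f s, T.edge (d, .γ) = (f, .ε) ∧ T.edge (f, .α) = (s, .δ) ∧ T.edge (s, .β) = (d, .β)

/-- Around the far end of the edge `γε` of the tile `d`, the third tile has its corner `δ`, as in the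
mirror image of the pentagonal subdivision. -/
def IsReversedAt {G : Type*} (T : LabelledMap (G × Label5) Label3) (d : G) : Prop :=
  ∃ f s, T.edge (d, .γ) = (f, .ε) ∧ T.edge (f, .α) = (s, .α) ∧ T.edge (s, .δ) = (d, .β)

variable {G : Type u} [Fintype G] {T : LabelledMap (G × Label5) Label3} {k : ℕ}

/-! ### Regular and reversed vertices -/

theorem IsLocalTiling.label_vertex {D : Type*} [Fintype D] {T : LabelledMap D Label3}
    (h : T.IsLocalTiling k) (d : D) : T.label (T.vertex d) = .γ ↔ T.label d = .γ := by
  have h0 := mem_orbitLabels_pow T.vertex T.label d 0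
  have h1 := mem_orbitLabels_pow T.vertex T.label d 1
  rw [pow_zero, Equiv.Perm.one_apply] at h0
  rw [pow_one] at h1
  rcases h.vertex d with h2 | h2 | h2 <;> rw [h2] at h0 h1
  · generalize T.label d = x, T.label (T.vertex d) = y at h0 h1 ⊢
    revert x y; decide
  · generalize T.label d = x, T.label (T.vertex d) = y at h0 h1 ⊢
    revert x y; decide
  · rw [Multiset.eq_of_mem_replicate h0, Multiset.eq_of_mem_replicate h1]

theorem IsLocalTiling.vertex_three {D : Type*} [Fintype D] {T : LabelledMap D Label3}
    (h : T.IsLocalTiling k) {d : D} (hd : T.label d ≠ .γ) :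
    T.vertex (T.vertex (T.vertex d)) = d := by
  have h1 := pow_card_orbitLabels T.vertex T.label d
  rcases h.vertex d with h2 | h2 | h2
  · rw [h2] at h1; exact h1
  · rw [h2] at h1; exact h1
  · have h0 := mem_orbitLabels_pow T.vertex T.label d 0
    rw [h2] at h0
    exact absurd (Multiset.eq_of_mem_replicate h0) hd

namespace IsStandard

variable (hs : T.IsStandard)
include hs

omit [Fintype G] in
theorem face_eq : T.face = Equiv.prodCongr (Equiv.refl G) nextCorner :=
  Equiv.ext fun ⟨d, c⟩ => hs.face_apply d c

omit [Fintype G] in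
theorem vertex_eq_iff {x : G × Label5} {d : G} {c : Label5} :
    T.vertex x = (d, nextCorner c) ↔ T.edge x = (d, c) := by
  rw [OrientedMap.vertex, Equiv.Perm.mul_apply, ← hs.face_apply, T.face.injective.eq_iff]

/-- The permutation that sends a tile to the next tile, counterclockwise, that has the same
vertex `γ⋯γ`, when the corners `ε` are viewed as darts of the polyhedron. -/
theorem exists_next (h : T.IsLocalTiling k) :
    ∃ F : Equiv.Perm G, ∀ d, T.edge (d, .γ) = (F d, .ε) := by
  have h1 : ∀ d, ∃ f, T.edge (d, .γ) = (f, .ε) := by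
    intro d
    obtain ⟨⟨f, c⟩, hf⟩ := T.vertex.surjective (d, .ε)
    have hc : c = .ε := by
      rw [← hs.label_eq f c, ← h.label_vertex, hf, hs.label_eq]
    subst hc
    have := (hs.vertex_eq_iff (c := .γ)).1 hf
    exact ⟨f, by rw [← this, T.edge_edge]⟩
  choose F hF using h1
  have hinj : Function.Injective F := fun d d' hd => by
    have := T.edge.injective ((hF d).trans ((congr_arg (fun f => (f, Label5.ε)) hd).trans
      (hF d').symm))
    exact congr_arg Prod.fst this
  exact ⟨Equiv.ofBijective F (Finite.injective_iff_bijective.1 hinj), hF⟩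

end IsStandard

namespace IsStandard

variable (hs : T.IsStandard)
include hs

/-- The vertex has degree three and contains `(d, .γ)` followed by `(F d, .α)`. The third corner is
not ε, as its label is not γ; not α, since in the rotation every corner α comes right after a corner
γ; and not γ, since every corner γ is followed by a corner α. -/
theorem isRegularAt_or_isReversedAt (h : T.IsLocalTiling k) (d : G) : T.IsRegularAt d ∨ T.IsReversedAt d := by
  obtain ⟨F, hF⟩ := hs.exists_next h
  have h1 : T.vertex (d, .γ) = (F d, .α) := (hs.vertex_eq_iff (c := .ε)).2 (hF d)
  obtain ⟨s, c, hc⟩ : ∃ s c, T.vertex (F d, .α) = (s, c) := ⟨_, _, rfl⟩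
  have h3 : T.vertex (s, c) = (d, .γ) := by
    rw [← hc, ← h1]
    exact h.vertex_three fun h0 => by cases (hs.label_eq _ _).1 h0
  cases c with
  | ε =>
    have := (h.label_vertex (F d, .α))
    rw [hc, hs.label_eq, hs.label_eq] at this
    simp at this
  | α =>
    have h4 : T.vertex (F.symm s, .γ) = (s, .α) := by
      have := (hs.vertex_eq_iff (c := .ε)).2 (hF (F.symm s))
      rwa [Equiv.apply_symm_apply] at this
    cases congr_arg Prod.snd (T.vertex.injective (h4.trans hc.symm))
  | γ =>
    have h4 : T.vertex (s, .γ) = (F s, .α) := (hs.vertex_eq_iff (c := .ε)).2 (hF s)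
    cases congr_arg Prod.snd (h3.symm.trans h4)
  | δ =>
    exact Or.inr ⟨F d, s, hF d, (hs.vertex_eq_iff (c := .α)).1 hc, (hs.vertex_eq_iff (c := .β)).1 h3⟩
  | β =>
    exact Or.inl ⟨F d, s, hF d, (hs.vertex_eq_iff (c := .δ)).1 hc, (hs.vertex_eq_iff (c := .β)).1 h3⟩

/-- Regularity passes across each of the five sides of a tile, so it spreads over the connected
surface. -/
theorem isRegularAt_of_isRegularAt (h : T.IsLocalTiling k) {d : G} (hd : T.IsRegularAt d) (d' : G) :
    T.IsRegularAt d' := by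
  obtain ⟨F, hF⟩ := hs.exists_next h
  have symm : ∀ {x y}, T.edge x = y → T.edge y = x := fun {x y} hxy => by rw [← hxy, T.edge_edge]
  have hFf : ∀ {d f}, T.edge (d, .γ) = (f, .ε) → f = F d := fun {d f} hd =>
    congr_arg Prod.fst (hd.symm.trans (hF d))
  -- A side β glued to a side β already proves regularity, because in the reversed case it is glued
  -- to a side δ.
  have hβ : ∀ {s u}, T.edge (s, .β) = (u, .β) → T.IsRegularAt s := by
    intro s u hu
    rcases hs.isRegularAt_or_isReversedAt h s with h1 | ⟨f, s', -, -, h2⟩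
    · exact h1
    · cases congr_arg Prod.snd (hu.symm.trans (symm h2))
  -- the third tile at a regular vertex
  have hδ : ∀ {s}, T.IsRegularAt s → ∃ u, T.IsRegularAt u ∧ T.edge (s, .δ) = (F u, .α) ∧
      T.edge (s, .β) = (u, .β) := by
    rintro s ⟨f, u, -, -, hu⟩
    obtain ⟨f', s', hf', h1, h2⟩ := hβ hu
    have hss : s' = s := congr_arg Prod.fst ((symm h2).symm.trans hu)
    subst hss
    rw [hFf hf'] at h1
    exact ⟨u, hβ hu, symm h1, h2⟩
  -- If the preceding tile were reversed, the sides α of `s` and some `r` would be glued. Then the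
  -- tile before `r` is reversed as well, which glues the side δ of `s` to a side β, contradicting
  -- `hδ`.
  have hprev : ∀ {s}, T.IsRegularAt s → T.IsRegularAt (F.symm s) := by
    intro s h1
    rcases hs.isRegularAt_or_isReversedAt h (F.symm s) with h2 | ⟨f, r, hf, hr, -⟩
    · exact h2
    · exfalso
      rw [hFf hf, Equiv.apply_symm_apply] at hr
      rcases hs.isRegularAt_or_isReversedAt h (F.symm r) with ⟨f', s', hf', h3, -⟩ |
        ⟨f', s', hf', h3, h4⟩
      · rw [hFf hf', Equiv.apply_symm_apply] at h3
        cases congr_arg Prod.snd ((symm hr).symm.trans h3)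
      · rw [hFf hf', Equiv.apply_symm_apply] at h3
        have hss : s' = s := congr_arg Prod.fst (h3.symm.trans (symm hr))
        subst hss
        obtain ⟨u, -, h5, -⟩ := hδ h1
        cases congr_arg Prod.snd (h4.symm.trans h5)
  have hnext : ∀ {s}, T.IsRegularAt s → T.IsRegularAt (F s) := by
    intro s h1
    have hpow : ∀ n : ℕ, T.IsRegularAt ((F⁻¹ ^ n) s) := by
      intro n
      induction n with
      | zero => exact h1
      | succ n ih => rw [pow_succ', Equiv.Perm.mul_apply]; exact hprev ih
    -- `F` has finite order, so it is a power of its inverse and going back repeatedly also goes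
    -- forward.
    have : F⁻¹ ^ (orderOf F⁻¹ - 1) = F := by
      rw [inv_pow, inv_eq_iff_mul_eq_one, orderOf_inv, ← pow_succ,
        Nat.sub_add_cancel (orderOf_pos F), pow_orderOf_eq_one]
    rw [← this]
    exact hpow _
  have hmain : ∀ x : G × Label5, T.IsRegularAt x.1 → T.IsRegularAt (T.edge x).1 := by
    rintro ⟨s, c⟩ h1
    cases c with
    | γ => rw [hF]; exact hnext h1
    | ε =>
      have := symm (hF (F.symm s))
      rw [Equiv.apply_symm_apply] at this
      rw [this]; exact hprev h1
    | β => obtain ⟨u, h2, -, h3⟩ := hδ h1; rw [h3]; exact h2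
    | δ => obtain ⟨u, h2, h3, -⟩ := hδ h1; rw [h3]; exact hnext h2
    | α =>
      obtain ⟨f, u, hf, h3, h4⟩ := hprev h1
      rw [hFf hf, Equiv.apply_symm_apply] at h3
      rw [h3]; exact hβ h4
  exact OrientedMap.isConnected_iff.1 h.connected (fun x => T.IsRegularAt x.1)
    (fun ⟨d, c⟩ => by rw [hs.face_apply])
    (fun x => ⟨fun hx => by have := hmain _ hx; rwa [T.edge_edge] at this, hmain x⟩)
    (d, .ε) (d', .ε) hd

/-- The darts of the polyhedron are the tiles: its `face` is the passage to the next tile around γᵏ,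
its `edge` the gluing of the sides β. -/
theorem exists_eq_labelledSubdivision (h : T.IsLocalTiling k) (hr : ∀ d, T.IsRegularAt d) :
    ∃ M : OrientedMap G, T = labelledSubdivision M T.label := by
  obtain ⟨F, hF⟩ := hs.exists_next h
  choose f E hf h1 h2 using hr
  have hf' : ∀ d, f d = F d := fun d => congr_arg Prod.fst ((hf d).symm.trans (hF d))
  simp only [hf'] at h1
  have h3 : ∀ d, T.edge (d, .β) = (E d, .β) := fun d => by rw [← h2 d, T.edge_edge]
  have hEE : ∀ d, E (E d) = d := fun d => congr_arg Prod.fst ((h3 (E d)).symm.trans (h2 d))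
  let M : OrientedMap G :=
    { face := F
      edge := (show Function.Involutive E from hEE).toPerm
      edge_edge := hEE
      edge_ne := fun d hd => T.edge_ne (d, .β) ((h3 d).trans (congr_arg (fun e => (e, Label5.β)) hd)) }
  refine ⟨M, ?_⟩
  have hface : T.face = (pentSubdivision M).face := hs.face_eq
  have hedge : T.edge = (pentSubdivision M).edge := by
    ext1 ⟨d, c⟩
    cases c with
    | γ => exact hF d
    | β => exact h3 d
    | ε =>
      change _ = (F.symm d, Label5.γ)
      have := hF (F.symm d)
      rw [Equiv.apply_symm_apply] at this
      rw [← this, T.edge_edge]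
    | α =>
      change _ = (E (F.symm d), Label5.δ)
      have := h1 (F.symm d)
      rwa [Equiv.apply_symm_apply] at this
    | δ =>
      change _ = (F (E d), Label5.α)
      have := h1 (E d)
      rw [hEE] at this
      rw [← this, T.edge_edge]
  exact eq_of_face_edge_label hface hedge rfl

omit [Fintype G] in
/-- The mirror image of a map in standard form, if some vertex is reversed, is isomorphic to a map
in standard form with a regular vertex. -/
theorem exists_mirror {d : G} (hd : T.IsReversedAt d) :
    ∃ T' : LabelledMap (G × Label5) Label3, T.mirror.Isomorphic T' ∧ T'.IsStandard ∧
      ∃ d, T'.IsRegularAt d := by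
  -- The reflection fixing ε restores the counterclockwise order of the corner names.
  let ρ : Equiv.Perm Label5 :=
    { toFun := fun | .ε => .ε | .α => .γ | .γ => .α | .δ => .β | .β => .δ
      invFun := fun | .ε => .ε | .α => .γ | .γ => .α | .δ => .β | .β => .δ
      left_inv := fun c => by cases c <;> rfl
      right_inv := fun c => by cases c <;> rfl }
  let e : G × Label5 ≃ G × Label5 := Equiv.prodCongr (Equiv.refl G) ρ
  have hinv : ∀ d c, T.face⁻¹ (d, c) = (d, nextCorner.symm c) := fun d c => by
    rw [Equiv.Perm.inv_eq_iff_eq, hs.face_apply, Equiv.apply_symm_apply]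
  have hface : ∀ d c, (T.mirror.transport e).face (d, c) = e (T.face⁻¹ (d, ρ.symm c)) :=
    fun _ _ => rfl
  have hedge : ∀ d c, (T.mirror.transport e).edge (d, c) =
      e (T.face (T.edge (T.face⁻¹ (d, ρ.symm c)))) := fun _ _ => rfl
  refine ⟨T.mirror.transport e, isomorphic_transport _ _, ⟨?_, ?_⟩, ?_⟩
  · intro d c
    rw [hface, hinv]
    cases c <;> rfl
  · intro d c
    change T.label (d, ρ.symm c) = .γ ↔ _
    rw [hs.label_eq]
    cases c <;> simp [ρ]
  · obtain ⟨f, s, h1, h2, h3⟩ := hd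
    have symm : ∀ {x y}, T.edge x = y → T.edge y = x := fun {x y} hxy => by rw [← hxy, T.edge_edge]
    -- The mirror image reverses the order of tiles around γᵏ, so `f` now precedes `d`.
    refine ⟨f, d, s, ?_, ?_, ?_⟩
    · rw [hedge, hinv]
      change e (T.face (T.edge (f, .ε))) = _
      rw [symm h1, hs.face_apply]; rfl
    · rw [hedge, hinv]
      change e (T.face (T.edge (d, .β))) = _
      rw [symm h3, hs.face_apply]; rfl
    · rw [hedge, hinv]
      change e (T.face (T.edge (s, .α))) = _
      rw [symm h2, hs.face_apply]; rfl

end IsStandard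

theorem IsTilingFor.exists_labelledSubdivision {D : Type u} [Fintype D] {T : LabelledMap D Label3}
    {k a b c : ℕ} (h : T.IsTilingFor (avc k a b c)) :
    ∃ (G : Type u) (_ : Fintype G) (M : OrientedMap G) (l : G × Label5 → Label3),
      (T.Isomorphic (labelledSubdivision M l) ∨ T.mirror.Isomorphic (labelledSubdivision M l)) ∧
      (labelledSubdivision M l).IsTilingFor (avc k a b c) ∧
      ∀ d c, l (d, c) = .γ ↔ c = .ε := by
  obtain ⟨G, _, T', hT, hs⟩ := h.isLocalTiling.exists_isStandard
  have h' := hT.symm.isTilingFor h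
  by_cases hall : ∀ d, T'.IsRegularAt d
  · obtain ⟨M, hM⟩ := hs.exists_eq_labelledSubdivision h'.isLocalTiling hall
    exact ⟨G, inferInstance, M, T'.label, Or.inl (hM ▸ hT), hM ▸ h', hs.label_eq⟩
  · push Not at hall
    obtain ⟨d, hd⟩ := hall
    have hd := (hs.isRegularAt_or_isReversedAt h'.isLocalTiling d).resolve_left hd
    obtain ⟨T'', hT', hs', d', hd'⟩ := hs.exists_mirror hd
    have h'' := hT'.symm.isTilingFor h'.mirror
    obtain ⟨M, hM⟩ := hs'.exists_eq_labelledSubdivision h''.isLocalTiling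
      (hs'.isRegularAt_of_isRegularAt h''.isLocalTiling hd')
    exact ⟨G, inferInstance, M, T''.label, Or.inr (hM ▸ hT.mirror.trans hT'), hM ▸ h'',
      hs'.label_eq⟩

end LabelledMap

end Standard

/-! ### Labels of the pentagonal subdivision -/

section Labels

namespace LabelledMap

theorem IsLocalTiling.labels_vertex {D : Type*} [Fintype D] {T : LabelledMap D Label3} {k : ℕ}
    (h : T.IsLocalTiling k) {d : D} (hd : T.label d ≠ .γ) :
    ({T.label d, T.label (T.vertex d), T.label (T.vertex (T.vertex d))} : Multiset Label3) =
        {.α, .α, .β} ∨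
      ({T.label d, T.label (T.vertex d), T.label (T.vertex (T.vertex d))} : Multiset Label3) =
        {.β, .β, .β} := by
  have h1 : orbitLabels T.vertex T.label d = {.α, .α, .β} ∨
      orbitLabels T.vertex T.label d = {.β, .β, .β} := by
    rcases h.vertex d with h2 | h2 | h2
    · exact Or.inl h2
    · exact Or.inr h2
    · have h0 := mem_orbitLabels_pow T.vertex T.label d 0
      rw [h2] at h0
      exact absurd (Multiset.eq_of_mem_replicate h0) hd
  have h3 : Function.minimalPeriod T.vertex d = 3 := by
    rw [← card_orbitLabels T.vertex T.label d]
    rcases h1 with h1 | h1 <;> rw [h1] <;> rfl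
  rw [orbitLabels_three rfl rfl (h.vertex_three hd)] at h1
  · exact h1
  · intro h0
    have := Function.minimalPeriod_eq_one_iff_isFixedPt.2 h0.symm
    rw [h3] at this
    cases this

end LabelledMap

open LabelledMap

variable {G : Type*} [Fintype G] {M : OrientedMap G} {l : G × Label5 → Label3} {k : ℕ}
  (h : (labelledSubdivision M l).IsLocalTiling k) (hl : ∀ d c, l (d, c) = .γ ↔ c = .ε)

include h

/-! ### Properties inherited by the underlying map -/

theorem isConnected_of_subdivision : M.IsConnected := by
  rw [OrientedMap.isConnected_iff]
  intro p hf he x y hx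
  have hf' : ∀ d, p (M.face⁻¹ d) ↔ p d := fun d => by
    rw [← hf, ← Equiv.Perm.mul_apply, mul_inv_cancel, Equiv.Perm.one_apply]
  refine OrientedMap.isConnected_iff.1 h.connected (fun z => p z.1) (fun _ => Iff.rfl) ?_
    (x, .ε) (y, .ε) hx
  rintro ⟨d, c⟩
  change p (subdivisionEdge M (d, c)).1 ↔ p d
  cases c <;> simp only [subdivisionEdge, hf, he, hf']

include hl

theorem face_pow_of_subdivision (d : G) : (M.face ^ k) d = d := by
  have h1 : Function.minimalPeriod (labelledSubdivision M l).vertex (d, .ε) = k := by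
    rw [← card_orbitLabels _ (labelledSubdivision M l).label]
    have h0 := mem_orbitLabels_pow (labelledSubdivision M l).vertex l (d, .ε) 0
    rw [pow_zero, Equiv.Perm.one_apply, (hl d .ε).2 rfl] at h0
    rcases h.vertex (d, .ε) with h2 | h2 | h2
    · change orbitLabels (labelledSubdivision M l).vertex l (d, .ε) = _ at h2
      rw [h2] at h0; exact absurd h0 (by decide)
    · change orbitLabels (labelledSubdivision M l).vertex l (d, .ε) = _ at h2
      rw [h2] at h0; exact absurd h0 (by decide)
    · rw [h2, Multiset.card_replicate]
  rw [minimalPeriod_subdivision_ε] at h1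
  rw [← Equiv.Perm.iterate_eq_pow, ← h1]
  exact Function.iterate_minimalPeriod

theorem vertex_three_of_subdivision (d : G) : M.vertex (M.vertex (M.vertex d)) = d :=
  congr_arg Prod.fst (h.vertex_three (d := (d, .δ)) fun h0 => by cases (hl _ _).1 h0)

theorem labels_subdivision_δ (d : G) :
    ({l (d, .δ), l (M.vertex d, .δ), l (M.vertex (M.vertex d), .δ)} : Multiset Label3) =
        {.α, .α, .β} ∨
      ({l (d, .δ), l (M.vertex d, .δ), l (M.vertex (M.vertex d), .δ)} : Multiset Label3) =
        {.β, .β, .β} :=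
  h.labels_vertex (d := (d, .δ)) fun h0 => by cases (hl _ _).1 h0

theorem labels_subdivision_γ (d : G) :
    ({l (d, .γ), l (M.face d, .α), l (M.edge d, .β)} : Multiset Label3) = {.α, .α, .β} ∨
      ({l (d, .γ), l (M.face d, .α), l (M.edge d, .β)} : Multiset Label3) = {.β, .β, .β} := by
  have h1 := h.labels_vertex (d := (d, .γ)) fun h0 => by cases (hl _ _).1 h0
  have h2 : (labelledSubdivision M l).vertex ((labelledSubdivision M l).vertex (d, .γ)) =
    (M.edge d, .β) := congr_arg (fun e => (M.edge e, Label5.β)) (M.face.symm_apply_apply d)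
  rw [h2] at h1
  exact h1

/-- Without flips every vertex of degree three has an even number of α, and each exchange changes
the parity; the admissible vertices α²β and β³ have even parity too. -/
theorem isFlip_of_isLocalTiling {r : Label5 → Label3} {x : G → Bool} (hlr : l = flipLabel r x)
    (hr : r = red3D1 ∨ r = red3D3) : IsFlip M x := by
  constructor
  · intro d
    have h1 := labels_subdivision_γ h hl d
    simp only [hlr, flipLabel] at h1
    generalize x d = a, x (M.face d) = b, x (M.edge d) = c at *
    clear hlr h hl
    rcases hr with rfl | rfl <;> revert a b c <;> decide
  · intro d
    have h1 := labels_subdivision_δ h hl d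
    simp only [hlr, flipLabel] at h1
    generalize x d = a, x (M.vertex d) = b, x (M.vertex (M.vertex d)) = c at *
    clear hlr h hl
    rcases hr with rfl | rfl <;> revert a b c <;> decide

theorem exists_word [Nonempty G] : ∃ a b c e : Label3,
    (∀ d, l (d, .α) = a ∧ l (d, .δ) = b ∧ l (d, .β) = c ∧ l (d, .γ) = e ∨
      l (d, .α) = e ∧ l (d, .δ) = c ∧ l (d, .β) = b ∧ l (d, .γ) = a) ∧
    ({e, c, b, a, .γ} : Multiset Label3) = {.α, .α, .β, .β, .γ} := by
  obtain ⟨w, hw⟩ := h.congruent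
  obtain ⟨d₀⟩ := ‹Nonempty G›
  have hw' : ∀ d, ∃ k : ZMod 5, (∀ i : ℕ, l (d, (nextCorner ^ i) .ε) = w (k + i)) ∨
      (∀ i : ℕ, l (d, (nextCorner ^ i) .ε) = w (k - i)) := fun d => by
    have := hw (d, .ε)
    simp only [subdivision_face_pow] at this
    exact this
  obtain ⟨k₀, hk₀⟩ := hw' d₀
  -- The word contains γ only once, so all tiles start reading at the same place and differ at most
  -- in direction.
  have huniq : ∀ j, w j = .γ → j = k₀ := by
    intro j hj
    rcases hk₀ with hk₀ | hk₀
    · have h1 := hk₀ (j - k₀).val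
      rw [ZMod.natCast_val, ZMod.cast_id, add_sub_cancel, hj, hl] at h1
      have h2 := cornerIndex_pow .ε (j - k₀).val
      rw [h1, ZMod.natCast_val, ZMod.cast_id, left_eq_add] at h2
      exact sub_eq_zero.1 h2
    · have h1 := hk₀ (k₀ - j).val
      rw [ZMod.natCast_val, ZMod.cast_id, sub_sub_cancel, hj, hl] at h1
      have h2 := cornerIndex_pow .ε (k₀ - j).val
      rw [h1, ZMod.natCast_val, ZMod.cast_id, left_eq_add] at h2
      exact (sub_eq_zero.1 h2).symm
  have hword : ∀ d, (∀ i : ℕ, l (d, (nextCorner ^ i) .ε) = w (k₀ + i)) ∨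
      (∀ i : ℕ, l (d, (nextCorner ^ i) .ε) = w (k₀ - i)) := by
    intro d
    obtain ⟨k, hk⟩ := hw' d
    have : k = k₀ := by
      apply huniq
      rcases hk with hk | hk
      · have := hk 0
        rw [Nat.cast_zero, add_zero] at this; exact this.symm.trans ((hl d .ε).2 rfl)
      · have := hk 0
        rw [Nat.cast_zero, sub_zero] at this; exact this.symm.trans ((hl d .ε).2 rfl)
    rwa [this] at hk
  have e1 : ((1 : ℕ) : ZMod 5) = -((4 : ℕ) : ZMod 5) := by decide
  have e2 : ((2 : ℕ) : ZMod 5) = -((3 : ℕ) : ZMod 5) := by decide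
  have hmain : ∀ d, l (d, .α) = w (k₀ + (1 : ℕ)) ∧ l (d, .δ) = w (k₀ + (2 : ℕ)) ∧
      l (d, .β) = w (k₀ - (2 : ℕ)) ∧ l (d, .γ) = w (k₀ - (1 : ℕ)) ∨
      l (d, .α) = w (k₀ - (1 : ℕ)) ∧ l (d, .δ) = w (k₀ - (2 : ℕ)) ∧
      l (d, .β) = w (k₀ + (2 : ℕ)) ∧ l (d, .γ) = w (k₀ + (1 : ℕ)) := by
    intro d
    rcases hword d with hd | hd
    · left
      refine ⟨hd 1, hd 2, ?_, ?_⟩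
      · rw [e2, sub_neg_eq_add]; exact hd 3
      · rw [e1, sub_neg_eq_add]; exact hd 4
    · right
      refine ⟨hd 1, hd 2, ?_, ?_⟩
      · rw [e2, ← sub_eq_add_neg]; exact hd 3
      · rw [e1, ← sub_eq_add_neg]; exact hd 4
  refine ⟨_, _, _, _, hmain, ?_⟩
  have ht := h.map_label_face (d₀, .ε)
  simp only [Multiset.range_succ, Multiset.range_zero, Multiset.map_cons, Multiset.map_zero,
    subdivision_face_pow] at ht
  change ({l (d₀, .γ), l (d₀, .β), l (d₀, .δ), l (d₀, .α), l (d₀, .ε)} : Multiset Label3) = _ at ht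
  rw [(hl _ _).2 rfl] at ht
  have hrev : ∀ a b c e : Label3, ({a, b, c, e, .γ} : Multiset Label3) = {e, c, b, a, .γ} := by
    decide
  rcases hmain d₀ with ⟨h1, h2, h3, h4⟩ | ⟨h1, h2, h3, h4⟩
  · rw [← h1, ← h2, ← h3, ← h4]; exact ht
  · rw [← h1, ← h2, ← h3, ← h4, hrev]; exact ht

theorem exists_flipLabel [Nonempty G] : ∃ (r : Label5 → Label3) (x : G → Bool),
    l = flipLabel r x ∧ IsFlip M x ∧ (r = red3D1 ∨ r = red3D3 ∨ r = red3D2 ∧ x = fun _ => false) := by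
  obtain ⟨a, b, c, e, hw, ht⟩ := exists_word h hl
  have hε : ∀ d, l (d, .ε) = .γ := fun d => (hl d .ε).2 rfl
  -- The six arrangements of α, α, β, β up to reversal: two reversal pairs, giving 3D₁ and 3D₃, and
  -- two palindromes.
  have hcases : ∀ a b c e : Label3, ({e, c, b, a, .γ} : Multiset Label3) = {.α, .α, .β, .β, .γ} →
      (a = .β ∧ b = .β ∧ c = .α ∧ e = .α ∨ a = .α ∧ b = .α ∧ c = .β ∧ e = .β) ∨
      (a = .α ∧ b = .β ∧ c = .α ∧ e = .β ∨ a = .β ∧ b = .α ∧ c = .β ∧ e = .α) ∨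
      (a = .α ∧ b = .β ∧ c = .β ∧ e = .α) ∨ (a = .β ∧ b = .α ∧ c = .α ∧ e = .β) := by
    decide
  rcases hcases a b c e ht with hc | hc | hc | hc
  · have hlr : l = flipLabel red3D1 fun d => l (d, .α) = .α := by
      funext ⟨d, q⟩
      have hd : (l (d, .α) = .β ∧ l (d, .δ) = .β ∧ l (d, .β) = .α ∧ l (d, .γ) = .α) ∨
          (l (d, .α) = .α ∧ l (d, .δ) = .α ∧ l (d, .β) = .β ∧ l (d, .γ) = .β) := by
        have := hw d
        rcases hc with ⟨rfl, rfl, rfl, rfl⟩ | ⟨rfl, rfl, rfl, rfl⟩ <;> tauto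
      rcases hd with ⟨h1, h2, h3, h4⟩ | ⟨h1, h2, h3, h4⟩ <;>
        cases q <;> simp [flipLabel, red3D1, swapAB, h1, h2, h3, h4, hε]
    exact ⟨_, _, hlr, isFlip_of_isLocalTiling h hl hlr (Or.inl rfl), Or.inl rfl⟩
  · have hlr : l = flipLabel red3D3 fun d => l (d, .α) = .β := by
      funext ⟨d, q⟩
      have hd : (l (d, .α) = .α ∧ l (d, .δ) = .β ∧ l (d, .β) = .α ∧ l (d, .γ) = .β) ∨
          (l (d, .α) = .β ∧ l (d, .δ) = .α ∧ l (d, .β) = .β ∧ l (d, .γ) = .α) := by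
        have := hw d
        rcases hc with ⟨rfl, rfl, rfl, rfl⟩ | ⟨rfl, rfl, rfl, rfl⟩ <;> tauto
      rcases hd with ⟨h1, h2, h3, h4⟩ | ⟨h1, h2, h3, h4⟩ <;>
        cases q <;> simp [flipLabel, red3D3, swapAB, h1, h2, h3, h4, hε]
    exact ⟨_, _, hlr, isFlip_of_isLocalTiling h hl hlr (Or.inr rfl), Or.inr (Or.inl rfl)⟩
  · obtain ⟨rfl, rfl, rfl, rfl⟩ := hc
    refine ⟨red3D2, fun _ => false, ?_, isFlip_false M, Or.inr (Or.inr ⟨rfl, rfl⟩)⟩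
    funext ⟨d, q⟩
    have := hw d
    -- For a palindrome the two directions of reading coincide.
    rw [or_iff_left_of_imp (fun h => h)] at this
    obtain ⟨h1, h2, h3, h4⟩ := this
    cases q <;> simp [flipLabel, red3D2, h1, h2, h3, h4, hε]
  · exfalso
    obtain ⟨rfl, rfl, rfl, rfl⟩ := hc
    -- The remaining palindrome would produce a vertex α³ at every vertex of the polyhedron.
    have hδ : ∀ d, l (d, .δ) = .α := fun d => by
      rcases hw d with h | h <;> exact h.2.1
    have := labels_subdivision_δ h hl (Classical.arbitrary G)
    rw [hδ, hδ, hδ] at this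
    revert this; decide

omit [Fintype G] h hl

/-! ### Flips -/

namespace IsFlip

variable {x : G → Bool} (hx : IsFlip M x)
include hx

/-- Adding the edge relations of `d` and of `M.edge d` over 𝔽₂ cancels everything but these two
terms. -/
theorem face_edge (d : G) : x (M.face (M.edge d)) = x (M.face d) := by
  have h1 := hx.edge d
  have h2 := hx.edge (M.edge d)
  rw [M.edge_edge] at h2
  rw [h1] at h2
  generalize x d = a, x (M.face d) = b, x (M.face (M.edge d)) = c at h2 ⊢
  revert a b c; decide

/-- The vertex relation at `M.edge d` involves `M.edge d`, `M.face d` and, by `face_edge`, the value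
at `M.face (M.face d)`; the edge relation at `d` eliminates the first. -/
theorem face_face (d : G) : x (M.face (M.face d)) = x d := by
  have h1 := hx.face_edge (M.face (M.edge (M.edge d)))
  have h2 := hx.vertex (M.edge d)
  have h3 := hx.edge d
  simp only [OrientedMap.vertex, Equiv.Perm.mul_apply, M.edge_edge] at h1 h2
  rw [h1, h3] at h2
  generalize x d = a, x (M.face d) = b, x (M.face (M.face d)) = c at h2 ⊢
  revert a b c; decide

/-- A flip is determined by its values at two neighbouring tiles of a face. -/
theorem eq_of_eq {y : G → Bool} (hy : IsFlip M y) (hM : M.IsConnected) {d : G} (h1 : x d = y d)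
    (h2 : x (M.face d) = y (M.face d)) : x = y := by
  funext e
  -- The pair of values at a dart and its successor determines the pair after `face`, which swaps
  -- the two, and after `edge`; so agreement of pairs spreads.
  have h := OrientedMap.isConnected_iff.1 hM (fun d => x d = y d ∧ x (M.face d) = y (M.face d))
    (fun d => by rw [hx.face_face, hy.face_face, and_comm])
    (fun d => by
      rw [hx.face_edge, hy.face_edge, hx.edge, hy.edge]
      constructor <;> rintro ⟨h1, h2⟩ <;> refine ⟨?_, h2⟩ <;> simpa [h2] using h1)
    d e ⟨h1, h2⟩
  exact h.1

theorem face_pow_two (n : ℕ) (d : G) : x ((M.face ^ (2 * n)) d) = x d := by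
  induction n with
  | zero => rfl
  | succ n ih =>
    rw [show 2 * (n + 1) = 2 * n + 1 + 1 by ring, pow_succ', pow_succ', Equiv.Perm.mul_apply,
      Equiv.Perm.mul_apply, hx.face_face, ih]

/-- Values alternate around a face, and odd length makes them constant there; the edge relation then
adds two equal values. -/
theorem eq_false_of_odd {k : ℕ} (hk : Odd k) (hM : ∀ d, (M.face ^ k) d = d) (d : G) :
    x d = false := by
  have h1 : ∀ d, x (M.face d) = x d := by
    intro d
    obtain ⟨n, rfl⟩ := hk
    conv_rhs => rw [← hM d, pow_succ, Equiv.Perm.mul_apply, hx.face_pow_two]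
  rw [← M.edge_edge d, hx.edge, h1, Bool.xor_self]

/-- If a flip is not trivial then it flips two neighbouring tiles of some face. -/
theorem exists_true {d : G} (hd : x d = true) : ∃ e, x e = true ∧ x (M.face e) = true := by
  cases h : x (M.face d)
  · refine ⟨M.edge (M.face d), ?_, ?_⟩
    · rw [hx.edge, hx.face_face, h, hd]; rfl
    · rw [hx.face_edge, hx.face_face, hd]
  · exact ⟨d, hd, h⟩

end IsFlip

end Labels

/-! ### Maps with the faces and vertices of a polyhedron -/

section Polyhedra

/-- The darts of `todo` can be added to `done` one after the other, so that before the step the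
opposite dart or the other two darts at the same vertex are present. -/
def checkOrder {A : Type*} [DecidableEq A] (E V : A → A) : List A → List A → Bool
  | [], _ => true
  | d :: todo, done =>
    (decide (E d ∈ done) || (decide (V d ∈ done) && decide (V (V d) ∈ done))) &&
      checkOrder E V todo (d :: done)

theorem forall_mem_of_checkOrder {A : Type*} [DecidableEq A] {E V : A → A} {P : A → Prop}
    (hE : ∀ d, P (E d) → P d) (hV : ∀ d, P (V d) → P (V (V d)) → P d) :
    ∀ {todo done : List A}, checkOrder E V todo done = true → (∀ d ∈ done, P d) →
      ∀ d ∈ todo, P d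
  | [], _, _, _ => by simp
  | d :: todo, done, h, hP => by
    simp only [checkOrder, Bool.and_eq_true, Bool.or_eq_true, decide_eq_true_eq] at h
    have hd : P d := h.1.elim (fun h => hE d (hP _ h)) fun h => hV d (hP _ h.1) (hP _ h.2)
    intro e he
    rcases List.mem_cons.1 he with rfl | he
    · exact hd
    · refine forall_mem_of_checkOrder hE hV h.2 ?_ e he
      intro e he
      rcases List.mem_cons.1 he with rfl | he
      · exact hd
      · exact hP e he

variable {G : Type*} {m n : ℕ} {N : OrientedMap (Fin m × Fin (n + 1))} {M : OrientedMap G}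

/-- Maps from a map with vertices of degree three: it is sufficient to prescribe the images of
the edges in a spanning tree of the faces. -/
theorem edge_apply_of_checkOrder {A : Type*} [DecidableEq A] {N : OrientedMap A}
    (hN : ∀ d, N.vertex (N.vertex (N.vertex d)) = d)
    (hM : ∀ d, M.vertex (M.vertex (M.vertex d)) = d) {φ : A → G}
    (hφ : ∀ d, φ (N.face d) = M.face (φ d)) {todo done : List A}
    (hdone : ∀ d ∈ done, φ (N.edge d) = M.edge (φ d))
    (hcheck : checkOrder N.edge N.vertex todo done = true) :
    ∀ d ∈ todo, φ (N.edge d) = M.edge (φ d) := by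
  refine forall_mem_of_checkOrder (P := fun d => φ (N.edge d) = M.edge (φ d)) ?_ ?_ hcheck hdone
  · intro d hd
    rw [N.edge_edge] at hd
    rw [hd, M.edge_edge]
  · intro d h1 h2
    have hv : ∀ d, φ (N.edge d) = M.edge (φ d) → φ (N.vertex d) = M.vertex (φ d) := by
      intro d hd
      simp only [OrientedMap.vertex, Equiv.Perm.mul_apply, hφ, hd]
    -- The map respects two of the three rotations around the vertex; the third follows because
    -- rotation has order three on both sides.
    have h4 : M.vertex (M.vertex (φ (N.vertex d))) = φ d := by
      rw [← hv _ h1, ← hv _ h2, hN]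
    have h5 : M.vertex (φ d) = φ (N.vertex d) := by rw [← h4, hM]
    apply M.face.injective
    rw [← hφ]
    exact h5.symm

theorem face_apply_of_pow (hf : ∀ i j, N.face (i, j) = (i, j + 1))
    (hM : ∀ d, (M.face ^ (n + 1)) d = d) (g : Fin m → G) (d : Fin m × Fin (n + 1)) :
    (fun d : Fin m × Fin (n + 1) => (M.face ^ d.2.val) (g d.1)) (N.face d) =
      M.face ((M.face ^ d.2.val) (g d.1)) := by
  obtain ⟨i, j⟩ := d
  have h1 : M.face ^ (n + 1) = 1 := Equiv.ext hM
  rw [hf]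
  change (M.face ^ ((j + 1 : Fin (n + 1)).val)) (g i) = _
  rw [← Equiv.Perm.mul_apply, ← pow_succ', Fin.val_add, Fin.val_one', Nat.add_mod_mod,
    ← pow_eq_pow_mod _ h1]

/-- The image is closed under `face` and `edge`, hence everything by connectedness, and equal
cardinality gives injectivity. -/
theorem bijective_of_equivariant {A : Type*} [Fintype A] [Fintype G] [Nonempty A]
    {N : OrientedMap A} (hM : M.IsConnected) (hcard : Fintype.card A = Fintype.card G) {φ : A → G}
    (hf : ∀ d, φ (N.face d) = M.face (φ d)) (he : ∀ d, φ (N.edge d) = M.edge (φ d)) :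
    Function.Bijective φ := by
  rw [Fintype.bijective_iff_surjective_and_card]
  refine ⟨fun y => ?_, hcard⟩
  refine OrientedMap.isConnected_iff.1 hM (fun y => ∃ x, φ x = y) (fun y => ⟨?_, ?_⟩)
    (fun y => ⟨?_, ?_⟩) (φ (Classical.arbitrary A)) y ⟨_, rfl⟩
  · rintro ⟨x, hx⟩
    refine ⟨N.face.symm x, M.face.injective ?_⟩
    rw [← hf, Equiv.apply_symm_apply, hx]
  · rintro ⟨x, rfl⟩
    exact ⟨_, hf x⟩
  · rintro ⟨x, hx⟩
    refine ⟨N.edge x, ?_⟩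
    rw [he, hx, M.edge_edge]
  · rintro ⟨x, rfl⟩
    exact ⟨_, he x⟩

/-- Leaving each face across its edge 0 leads to the face `i₀` in at most three steps. -/
theorem isConnected_of_faces (hf : ∀ i j, N.face (i, j) = (i, j + 1)) {i₀ : Fin m}
    (h : ∀ i, (N.edge (i, 0)).1 = i₀ ∨ (N.edge ((N.edge (i, 0)).1, 0)).1 = i₀ ∨
      (N.edge ((N.edge ((N.edge (i, 0)).1, 0)).1, 0)).1 = i₀) : N.IsConnected := by
  rw [OrientedMap.isConnected_iff]
  intro p h1 h2
  have h3 : ∀ i j, p (i, j) ↔ p (i, 0) := by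
    intro i j
    induction j using Fin.induction with
    | zero => rfl
    | succ j ih =>
      rw [← ih, ← h1 (i, j.castSucc), hf, Fin.coeSucc_eq_succ]
  have h4 : ∀ i, p (i, 0) ↔ p ((N.edge (i, 0)).1, 0) := fun i => by
    rw [← h2, ← h3 _ (N.edge (i, 0)).2]
  have h5 : ∀ i, p (i, 0) ↔ p (i₀, 0) := by
    intro i
    rcases h i with h | h | h
    · rw [h4, h]
    · rw [h4, h4, h]
    · rw [h4, h4, h4, h]
  rintro ⟨i, j⟩ ⟨i', j'⟩ hx
  rw [h3, h5] at hx ⊢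
  exact hx

end Polyhedra

theorem polyhedron_edge_eq {m k n : ℕ} {F : Fin m → Fin k → Fin n}
    {h : ∀ d, ∃! d', src F d' = tgt F d ∧ tgt F d' = src F d} {h' : ∀ d, src F d ≠ tgt F d}
    {d d' : Fin m × Fin k} (hd : src F d' = tgt F d ∧ tgt F d' = src F d) :
    (polyhedron F h h').edge d = d' :=
  (h d).unique (opposite_spec F h d) hd

/-! ### The cube -/

section Cube

/-- The edges of the cube. -/
def cubeEdge (d : Fin 6 × Fin 4) : Fin 6 × Fin 4 :=
  (![![(5, 0), (4, 0), (3, 0), (2, 0)],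
    ![(2, 2), (3, 2), (4, 2), (5, 2)],
    ![(0, 3), (3, 3), (1, 0), (5, 1)],
    ![(0, 2), (4, 3), (1, 1), (2, 1)],
    ![(0, 1), (5, 3), (1, 2), (3, 1)],
    ![(0, 0), (2, 3), (1, 3), (4, 1)]] : Fin 6 → Fin 4 → Fin 6 × Fin 4) d.1 d.2

theorem cube_face (i : Fin 6) (j : Fin 4) : cube.face (i, j) = (i, j + 1) :=
  Prod.ext rfl (finRotate_apply j)

theorem cube_edge (d : Fin 6 × Fin 4) : cube.edge d = cubeEdge d :=
  polyhedron_edge_eq (by revert d; decide)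

theorem cube_vertex (d : Fin 6 × Fin 4) :
    cube.vertex d = ((cubeEdge d).1, (cubeEdge d).2 + 1) := by
  rw [OrientedMap.vertex, Equiv.Perm.mul_apply, cube_edge]
  exact cube_face _ _

theorem cube_vertex_three (d : Fin 6 × Fin 4) : cube.vertex (cube.vertex (cube.vertex d)) = d := by
  simp only [cube_vertex]; revert d; decide

theorem minimalPeriod_cube_vertex (d : Fin 6 × Fin 4) :
    Function.minimalPeriod cube.vertex d = 3 := by
  refine minimalPeriod_eq_of_prime Nat.prime_three (cube_vertex_three d) ?_
  rw [cube_vertex]; revert d; decide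

theorem minimalPeriod_cube_face (d : Fin 6 × Fin 4) : Function.minimalPeriod cube.face d = 4 := by
  have : Fact (Nat.Prime 2) := ⟨Nat.prime_two⟩
  obtain ⟨i, j⟩ := d
  have h2 : ∀ j : Fin 4, j + 1 + 1 ≠ j := by decide
  have h4 : ∀ j : Fin 4, j + 1 + 1 + 1 + 1 = j := by decide
  -- The period divides 4 = 2² but not 2.
  have h := Function.minimalPeriod_eq_prime_pow (f := cube.face) (x := (i, j)) (p := 2) (k := 1)
    (fun h => h2 j ?_) ?_
  · exact h
  · have h : cube.face (cube.face (i, j)) = (i, j) := h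
    simpa only [cube_face, Prod.mk.injEq, true_and] using h
  · change cube.face (cube.face (cube.face (cube.face (i, j)))) = (i, j)
    simp only [cube_face, h4]

theorem isConnected_cube : cube.IsConnected := by
  refine isConnected_of_faces cube_face (i₀ := 0) ?_
  change ∀ i, (cube.edge (i, (0 : Fin 4))).1 = 0 ∨
    (cube.edge ((cube.edge (i, (0 : Fin 4))).1, (0 : Fin 4))).1 = 0 ∨
    (cube.edge ((cube.edge ((cube.edge (i, (0 : Fin 4))).1, (0 : Fin 4))).1,
      (0 : Fin 4))).1 = 0
  simp only [cube_edge]; decide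

theorem isFlip_isFlipped : IsFlip cube isFlipped := by
  constructor
  · rintro ⟨i, j⟩
    rw [cube_edge, cube_face]; revert i j; decide
  · intro d
    simp only [cube_vertex]; revert d; decide

variable {G : Type*} [Fintype G] {M : OrientedMap G}

theorem exists_equiv_cube (hM : M.IsConnected) (hf : ∀ d, (M.face ^ 4) d = d)
    (hv : ∀ d, M.vertex (M.vertex (M.vertex d)) = d) (hG : Fintype.card G = 24) (g : G) :
    ∃ φ : Fin 6 × Fin 4 ≃ G, φ (0, 0) = g ∧ (∀ d, φ (cube.face d) = M.face (φ d)) ∧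
      ∀ d, φ (cube.edge d) = M.edge (φ d) := by
  -- `a i` is the image of the dart `(i, 0)`, obtained from a face already placed across the edge
  -- `cubeEdge (i, 0)`. These five edges form the spanning tree `htree`.
  let a : Fin 6 → G := ![g, M.edge ((M.face ^ 2) (M.edge ((M.face ^ 3) g))),
    M.edge ((M.face ^ 3) g), M.edge ((M.face ^ 2) g), M.edge ((M.face ^ 1) g),
    M.edge ((M.face ^ 0) g)]
  let φ : Fin 6 × Fin 4 → G := fun d => (M.face ^ d.2.val) (a d.1)
  have hface : ∀ d, φ (cube.face d) = M.face (φ d) := face_apply_of_pow cube_face hf a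
  have htree : ∀ d ∈ ([(1, 0), (2, 0), (3, 0), (4, 0), (5, 0)] : List (Fin 6 × Fin 4)),
      φ (cube.edge d) = M.edge (φ d) := by
    intro d hd
    rw [cube_edge]
    simp only [List.mem_cons, List.not_mem_nil, or_false] at hd
    rcases hd with rfl | rfl | rfl | rfl | rfl <;> exact (M.edge_edge _).symm
  have hedge : ∀ d, φ (cube.edge d) = M.edge (φ d) := by
    have h := edge_apply_of_checkOrder cube_vertex_three hv hface htree (todo :=
    [(0, 0), (0, 1), (0, 2), (0, 3), (2, 1), (2, 2), (3, 1), (3, 3), (1, 1), (3, 2), (4, 1), (4,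
    3), (1, 2), (4, 2), (5, 1), (2, 3), (5, 2), (1, 3), (5, 3)]) (by
      rw [show ⇑cube.edge = cubeEdge from funext cube_edge,
        show ⇑cube.vertex = _ from funext cube_vertex]
      decide)
    intro d
    by_cases hd : d ∈ ([(1, 0), (2, 0), (3, 0), (4, 0), (5, 0)] : List (Fin 6 × Fin 4))
    · exact htree d hd
    · exact h d (by revert d; decide)
  have hbij := bijective_of_equivariant hM (by rw [hG]; rfl) hface hedge
  exact ⟨Equiv.ofBijective φ hbij, rfl, hface, hedge⟩

end Cube

/-! ### The dodecahedron -/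

section Dodecahedron

/-- The edges of the dodecahedron. -/
def dodecahedronEdge (d : Fin 12 × Fin 5) : Fin 12 × Fin 5 :=
  (![![(1, 0), (2, 0), (3, 0), (4, 0), (5, 0)],
    ![(0, 0), (5, 4), (10, 4), (6, 0), (2, 1)],
    ![(0, 1), (1, 4), (6, 4), (7, 0), (3, 1)],
    ![(0, 2), (2, 4), (7, 4), (8, 0), (4, 1)],
    ![(0, 3), (3, 4), (8, 4), (9, 0), (5, 1)],
    ![(0, 4), (4, 4), (9, 4), (10, 0), (1, 1)],
    ![(1, 3), (10, 3), (11, 3), (7, 1), (2, 2)],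
    ![(2, 3), (6, 3), (11, 2), (8, 1), (3, 2)],
    ![(3, 3), (7, 3), (11, 1), (9, 1), (4, 2)],
    ![(4, 3), (8, 3), (11, 0), (10, 1), (5, 2)],
    ![(5, 3), (9, 3), (11, 4), (6, 1), (1, 2)],
    ![(9, 2), (8, 2), (7, 2), (6, 2), (10, 2)]] : Fin 12 → Fin 5 → Fin 12 × Fin 5) d.1 d.2

theorem dodecahedron_face (i : Fin 12) (j : Fin 5) : dodecahedron.face (i, j) = (i, j + 1) :=
  Prod.ext rfl (finRotate_apply j)

theorem dodecahedron_edge (d : Fin 12 × Fin 5) : dodecahedron.edge d = dodecahedronEdge d :=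
  polyhedron_edge_eq (by revert d; decide +kernel)

theorem dodecahedron_vertex (d : Fin 12 × Fin 5) :
    dodecahedron.vertex d = ((dodecahedronEdge d).1, (dodecahedronEdge d).2 + 1) := by
  rw [OrientedMap.vertex, Equiv.Perm.mul_apply, dodecahedron_edge]
  exact dodecahedron_face _ _

theorem dodecahedron_vertex_three (d : Fin 12 × Fin 5) :
    dodecahedron.vertex (dodecahedron.vertex (dodecahedron.vertex d)) = d := by
  simp only [dodecahedron_vertex]; revert d; decide +kernel

theorem minimalPeriod_dodecahedron_vertex (d : Fin 12 × Fin 5) :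
    Function.minimalPeriod dodecahedron.vertex d = 3 := by
  refine minimalPeriod_eq_of_prime Nat.prime_three (dodecahedron_vertex_three d) ?_
  rw [dodecahedron_vertex]; revert d; decide +kernel

theorem minimalPeriod_dodecahedron_face (d : Fin 12 × Fin 5) :
    Function.minimalPeriod dodecahedron.face d = 5 := by
  obtain ⟨i, j⟩ := d
  have h1 : ∀ j : Fin 5, j + 1 ≠ j := by decide
  have h5 : ∀ j : Fin 5, j + 1 + 1 + 1 + 1 + 1 = j := by decide
  refine minimalPeriod_eq_of_prime Nat.prime_five ?_ fun h => h1 j ?_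
  · change dodecahedron.face (dodecahedron.face (dodecahedron.face (dodecahedron.face
      (dodecahedron.face (i, j))))) = (i, j)
    simp only [dodecahedron_face, h5]
  · simpa only [dodecahedron_face, Prod.mk.injEq, true_and] using h

theorem isConnected_dodecahedron : dodecahedron.IsConnected := by
  refine isConnected_of_faces dodecahedron_face (i₀ := 0) ?_
  change ∀ i, (dodecahedron.edge (i, (0 : Fin 5))).1 = 0 ∨
    (dodecahedron.edge ((dodecahedron.edge (i, (0 : Fin 5))).1, (0 : Fin 5))).1 = 0 ∨
    (dodecahedron.edge ((dodecahedron.edge ((dodecahedron.edge (i, (0 : Fin 5))).1, (0 : Fin 5))).1,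
      (0 : Fin 5))).1 = 0
  simp only [dodecahedron_edge]; decide +kernel

variable {G : Type*} [Fintype G] {M : OrientedMap G}

theorem exists_equiv_dodecahedron (hM : M.IsConnected) (hf : ∀ d, (M.face ^ 5) d = d)
    (hv : ∀ d, M.vertex (M.vertex (M.vertex d)) = d) (hG : Fintype.card G = 60) (g : G) :
    ∃ φ : Fin 12 × Fin 5 ≃ G, φ (0, 0) = g ∧ (∀ d, φ (dodecahedron.face d) = M.face (φ d)) ∧
      ∀ d, φ (dodecahedron.edge d) = M.edge (φ d) := by
  let b : Fin 5 → G := fun j => M.edge ((M.face ^ j.val) g)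
  let c : Fin 5 → G := fun j => M.edge ((M.face ^ 3) (b j))
  -- The base darts again come from a spanning tree of the faces: the five upper faces from the top,
  -- each lower face from an upper one, the bottom from a lower one.
  let a : Fin 12 → G := ![g, b 0, b 1, b 2, b 3, b 4, c 0, c 1, c 2, c 3, c 4,
    M.edge ((M.face ^ 2) (c 3))]
  let φ : Fin 12 × Fin 5 → G := fun d => (M.face ^ d.2.val) (a d.1)
  have hface : ∀ d, φ (dodecahedron.face d) = M.face (φ d) :=
    face_apply_of_pow dodecahedron_face hf a
  have htree : ∀ d ∈ ([(1, 0), (2, 0), (3, 0), (4, 0), (5, 0), (6, 0), (7, 0), (8, 0), (9, 0),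
      (10, 0), (11, 0)] : List (Fin 12 × Fin 5)), φ (dodecahedron.edge d) = M.edge (φ d) := by
    intro d hd
    rw [dodecahedron_edge]
    simp only [List.mem_cons, List.not_mem_nil, or_false] at hd
    rcases hd with rfl | rfl | rfl | rfl | rfl | rfl | rfl | rfl | rfl | rfl | rfl <;>
      exact (M.edge_edge _).symm
  have hedge : ∀ d, φ (dodecahedron.edge d) = M.edge (φ d) := by
    have h := edge_apply_of_checkOrder dodecahedron_vertex_three hv hface htree (todo :=
    [(0, 0), (0, 1), (0, 2), (0, 3), (0, 4), (1, 1), (1, 3), (2, 1), (1, 4), (2, 2), (2, 3), (3,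
    1), (2, 4), (3, 2), (3, 3), (4, 1), (3, 4), (4, 2), (4, 3), (5, 1), (4, 4), (5, 2), (5, 3),
    (5, 4), (1, 2), (6, 4), (7, 1), (6, 3), (7, 4), (8, 1), (7, 3), (8, 4), (9, 1), (8, 3), (9,
    2), (9, 4), (10, 1), (9, 3), (10, 2), (10, 4), (6, 1), (10, 3), (11, 1), (8, 2), (11, 2),
    (7, 2), (11, 3), (6, 2), (11, 4)]) (by
      rw [show ⇑dodecahedron.edge = dodecahedronEdge from funext dodecahedron_edge,
        show ⇑dodecahedron.vertex = _ from funext dodecahedron_vertex]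
      decide +kernel)
    intro d
    by_cases hd : d ∈ ([(1, 0), (2, 0), (3, 0), (4, 0), (5, 0), (6, 0), (7, 0), (8, 0), (9, 0),
      (10, 0), (11, 0)] : List (Fin 12 × Fin 5))
    · exact htree d hd
    · exact h d (by revert d; decide +kernel)
  have hbij := bijective_of_equivariant hM (by rw [hG]; rfl) hface hedge
  exact ⟨Equiv.ofBijective φ hbij, rfl, hface, hedge⟩

end Dodecahedron

/-! ### Classification -/

section Classification

open LabelledMap

theorem isomorphic_labelledSubdivision {A G : Type*} {N : OrientedMap A} {M : OrientedMap G}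
    (φ : A ≃ G) (hf : ∀ d, φ (N.face d) = M.face (φ d)) (he : ∀ d, φ (N.edge d) = M.edge (φ d))
    (r : Label5 → Label3) (x : G → Bool) :
    (labelledSubdivision M (flipLabel r x)).Isomorphic
      (labelledSubdivision N (flipLabel r (x ∘ φ))) := by
  have hinv : ∀ d, φ (N.face⁻¹ d) = M.face⁻¹ (φ d) := fun d => by
    rw [Equiv.Perm.eq_inv_iff_eq, ← hf, ← Equiv.Perm.mul_apply, mul_inv_cancel,
      Equiv.Perm.one_apply]
  refine Isomorphic.symm ⟨Equiv.prodCongr φ (Equiv.refl _), fun _ => rfl, ?_, fun _ => rfl⟩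
  rintro ⟨d, c⟩
  change Prod.map φ id (subdivisionEdge N (d, c)) = subdivisionEdge M (φ d, c)
  cases c <;> simp [subdivisionEdge, hf, he] <;> exact hinv d

theorem equivalent_of_isomorphic {D D' A : Type*} {T : LabelledMap D A} {X : LabelledMap D' A}
    (h : T.Isomorphic X ∨ T.mirror.Isomorphic X) : T.Equivalent X :=
  h.imp id fun h => T.mirror_mirror ▸ h.mirror

theorem IsTilingFor.exists_flipLabel {D : Type u} [Fintype D] {T : LabelledMap D Label3}
    {k a b c : ℕ} (h : T.IsTilingFor (avc k a b c)) (ha : a ≠ 0) :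
    ∃ (G : Type u) (_ : Fintype G) (M : OrientedMap G) (r : Label5 → Label3) (x : G → Bool),
      (T.Isomorphic (labelledSubdivision M (flipLabel r x)) ∨
        T.mirror.Isomorphic (labelledSubdivision M (flipLabel r x))) ∧
      M.IsConnected ∧ (∀ d, (M.face ^ k) d = d) ∧ (∀ d, M.vertex (M.vertex (M.vertex d)) = d) ∧
      Fintype.card G = a ∧ IsFlip M x ∧
      (r = red3D1 ∨ r = red3D3 ∨ r = red3D2 ∧ x = fun _ => false) := by
  obtain ⟨G, _, M, l, hT, h', hl⟩ := h.exists_labelledSubdivision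
  have hG : Fintype.card G = a := by
    have := h'.card_eq
    rw [Fintype.card_prod, show Fintype.card Label5 = 5 from rfl] at this
    omega
  have : Nonempty G := Fintype.card_pos_iff.1 (by omega)
  have hloc := h'.isLocalTiling
  obtain ⟨r, x, rfl, hx, hr⟩ := PentTiling.exists_flipLabel hloc hl
  exact ⟨G, inferInstance, M, r, x, hT, isConnected_of_subdivision hloc,
    face_pow_of_subdivision hloc hl, vertex_three_of_subdivision hloc hl, hG, hx, hr⟩

theorem isTilingFor_cube {r : Label5 → Label3} {x : Fin 6 × Fin 4 → Bool} (hx : IsFlip cube x)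
    (hr : r = red3D1 ∨ r = red3D3 ∨ r = red3D2 ∧ ∀ d, x d = false) :
    (labelledSubdivision cube (flipLabel r x)).IsTilingFor AVC3D24 := by
  rw [avc_24]
  exact (isLocalTiling_subdivision isConnected_cube minimalPeriod_cube_face
    minimalPeriod_cube_vertex hx hr).isTilingFor (by simp; rfl) (by norm_num) (by norm_num)
    (by norm_num) (by norm_num)

theorem isTilingFor_dodecahedron {r : Label5 → Label3}
    (hr : r = red3D1 ∨ r = red3D3 ∨ r = red3D2) :
    (PP12.relabel r).IsTilingFor AVC3D60 := by
  rw [avc_60]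
  exact (isLocalTiling_subdivision isConnected_dodecahedron minimalPeriod_dodecahedron_face
    minimalPeriod_dodecahedron_vertex (isFlip_false _)
    (hr.imp id (Or.imp id fun h => ⟨h, fun _ => rfl⟩))).isTilingFor (by simp; rfl) (by norm_num)
    (by norm_num) (by norm_num) (by norm_num)

theorem equivalent_of_isTilingFor_24 {D : Type u} [Fintype D] {T : LabelledMap D Label3}
    (h : T.IsTilingFor AVC3D24) :
    T.Equivalent (PP6.relabel red3D1) ∨ T.Equivalent (PP6.relabel red3D2) ∨
      T.Equivalent (PP6.relabel red3D3) ∨ T.Equivalent extraTiling3 ∨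
      T.Equivalent extraTiling1 := by
  rw [avc_24] at h
  obtain ⟨G, _, M, r, x, hT, hM, hf, hv, hG, hx, hr⟩ :=
    IsTilingFor.exists_flipLabel h (by norm_num)
  by_cases h0 : ∀ d, x d = false
  · obtain ⟨g⟩ : Nonempty G := Fintype.card_pos_iff.1 (by omega)
    obtain ⟨φ, -, hφf, hφe⟩ := exists_equiv_cube hM hf hv hG g
    have hiso := isomorphic_labelledSubdivision φ hφf hφe r x
    rw [show x ∘ φ = fun _ => false from funext fun d => h0 _] at hiso
    have hT := equivalent_of_isomorphic (hT.imp (·.trans hiso) (·.trans hiso))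
    rcases hr with rfl | rfl | ⟨rfl, -⟩
    · exact Or.inl hT
    · exact Or.inr (Or.inr (Or.inl hT))
    · exact Or.inr (Or.inl hT)
  · push Not at h0
    obtain ⟨d, hd⟩ := h0
    obtain ⟨g, h1, h2⟩ := hx.exists_true (Bool.eq_true_of_not_eq_false hd)
    -- Sending `(0, 0)` to a dart where `x` is true at it and at its successor makes `x ∘ φ` agree
    -- with `isFlipped` at two neighbouring tiles, hence everywhere.
    obtain ⟨φ, h0, hφf, hφe⟩ := exists_equiv_cube hM hf hv hG g
    have hiso := isomorphic_labelledSubdivision φ hφf hφe r x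
    have hxφ : IsFlip cube (x ∘ φ) := by
      constructor
      · intro d
        simp only [Function.comp_apply, hφf, hφe, hx.edge]
      · intro d
        simp only [Function.comp_apply, OrientedMap.vertex, Equiv.Perm.mul_apply, hφf, hφe]
        exact hx.vertex (φ d)
    rw [hxφ.eq_of_eq isFlip_isFlipped isConnected_cube (d := (0, 0))
      (by rw [Function.comp_apply, h0, h1]; rfl)
      (by rw [Function.comp_apply, hφf, h0, h2]; rfl)] at hiso
    have hT := equivalent_of_isomorphic (hT.imp (·.trans hiso) (·.trans hiso))
    rcases hr with rfl | rfl | ⟨-, rfl⟩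
    · exact Or.inr (Or.inr (Or.inr (Or.inr hT)))
    · exact Or.inr (Or.inr (Or.inr (Or.inl hT)))
    · exact absurd rfl hd

theorem equivalent_of_isTilingFor_60 {D : Type u} [Fintype D] {T : LabelledMap D Label3}
    (h : T.IsTilingFor AVC3D60) :
    T.Equivalent (PP12.relabel red3D1) ∨ T.Equivalent (PP12.relabel red3D2) ∨
      T.Equivalent (PP12.relabel red3D3) := by
  rw [avc_60] at h
  obtain ⟨G, _, M, r, x, hT, hM, hf, hv, hG, hx, hr⟩ :=
    IsTilingFor.exists_flipLabel h (by norm_num)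
  obtain ⟨g⟩ : Nonempty G := Fintype.card_pos_iff.1 (by omega)
  obtain ⟨φ, -, hφf, hφe⟩ := exists_equiv_dodecahedron hM hf hv hG g
  have hiso := isomorphic_labelledSubdivision φ hφf hφe r x
  rw [show x ∘ φ = fun _ => false from
    funext fun d => hx.eq_false_of_odd (by decide) hf _] at hiso
  have hT := equivalent_of_isomorphic (hT.imp (·.trans hiso) (·.trans hiso))
  rcases hr with rfl | rfl | ⟨rfl, -⟩
  · exact Or.inl hT
  · exact Or.inr (Or.inr hT)
  · exact Or.inr (Or.inl hT)

end Classification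

/-! ### The two further tilings -/

section Further

open LabelledMap

theorem extraTiling3_eq : extraTiling3 = labelledSubdivision cube (flipLabel red3D3 isFlipped) :=
  rfl

theorem extraTiling1_eq : extraTiling1 = labelledSubdivision cube (flipLabel red3D1 isFlipped) :=
  rfl

variable {G A : Type*} {M : OrientedMap G} {N : OrientedMap A} {l : G × Label5 → Label3}

/-- If all tiles of a map have the same labels, in the same direction, then two corners with the
unique label `γ` are followed by the same label. -/
theorem label_eq_of_isomorphic (hl : ∀ d c, l (d, c) = .γ ↔ c = .ε)
    {T : LabelledMap (A × Label5) Label3} {σ : Equiv.Perm Label5} {r : Label5 → Label3}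
    (hσ : ∀ c c', ∃ i < 5, (σ ^ i) c = c') (hface : ∀ d c, T.face (d, c) = (d, σ c))
    (hlabel : ∀ d c, T.label (d, c) = r c) (h : (labelledSubdivision M l).Isomorphic T) (d d' : G) :
    l (d, .α) = l (d', .α) := by
  obtain ⟨f, hf, -, hfl⟩ := h
  have hpow : ∀ (i : ℕ) d c, (T.face ^ i) (d, c) = (d, (σ ^ i) c) := by
    intro i d c
    induction i with
    | zero => rfl
    | succ i ih => rw [pow_succ', Equiv.Perm.mul_apply, ih, hface, pow_succ', Equiv.Perm.mul_apply]
  obtain ⟨e, c, hc⟩ : ∃ e c, f (d, .ε) = (e, c) := ⟨_, _, rfl⟩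
  obtain ⟨e', c', hc'⟩ : ∃ e c, f (d', .ε) = (e, c) := ⟨_, _, rfl⟩
  have hr' : r c' = .γ := by
    rw [← hlabel e', ← hc', hfl]; exact (hl _ _).2 rfl
  obtain ⟨i, hi, hic⟩ := hσ c c'
  have h1 : l (d, (nextCorner ^ i) .ε) = .γ := by
    rw [← hr', ← hic, ← hlabel e, ← hpow, ← hc, ← face_pow_equiv hf, hfl, subdivision_face_pow]
    rfl
  -- `f` carries i steps in the tile of `d` to i steps from `c` to `c'`; both ends are labelled γ,
  -- which occurs once per tile.
  have hi0 : i = 0 := by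
    have h2 := (hl _ _).1 h1
    interval_cases i <;> first | rfl | cases h2
  subst hi0
  have hcc : c = c' := hic
  subst hcc
  have h2 : ∀ {d e}, f (d, .ε) = (e, c) → l (d, .α) = r (σ c) := by
    intro d e hd
    have := hfl ((labelledSubdivision M l).face (d, .ε))
    rw [hf, hd, hface, hlabel] at this
    exact this.symm
  rw [h2 hc, h2 hc']

/-- In a relabelled subdivision, and in its mirror image, all tiles carry the word in the same
direction; the differing labels next to γ in two tiles exclude this. -/
theorem not_equivalent_relabel (hl : ∀ d c, l (d, c) = .γ ↔ c = .ε) {d d' : G}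
    (hd : l (d, .α) ≠ l (d', .α)) (r : Label5 → Label3) :
    ¬ (labelledSubdivision M l).Equivalent ((pentSubdivision N).relabel r) := by
  rintro (h | h)
  · exact hd (label_eq_of_isomorphic (σ := nextCorner) hl (by decide) (fun _ _ => rfl)
      (fun _ _ => rfl) h d d')
  · exact hd (label_eq_of_isomorphic (σ := nextCorner⁻¹) hl (by decide) (fun _ _ => rfl)
      (fun _ _ => rfl) h d d')

theorem flipLabel_eq_γ {r : Label5 → Label3} (hr : r = red3D1 ∨ r = red3D3) (x : G → Bool) (d : G)
    (c : Label5) : flipLabel r x (d, c) = .γ ↔ c = .ε := by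
  simp only [flipLabel]
  generalize x d = b
  rcases hr with rfl | rfl <;> revert b c <;> decide

theorem not_equivalent_extraTilings : ¬ extraTiling3.Equivalent extraTiling1 := by
  have hl := flipLabel_eq_γ (Or.inl rfl) isFlipped
  -- In the 3D₁ pentagon each neighbour of γ has the same label as the next corner, in either
  -- direction of reading; in the 3D₃ pentagon the labels alternate.
  have key : ∀ d, flipLabel red3D1 isFlipped (d, .α) = flipLabel red3D1 isFlipped (d, .δ) ∧
      flipLabel red3D1 isFlipped (d, .γ) = flipLabel red3D1 isFlipped (d, .β) := by decide
  rw [extraTiling3_eq, extraTiling1_eq]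
  rintro (⟨f, hf, -, hfl⟩ | ⟨f, hf, -, hfl⟩) <;>
    obtain ⟨e, c, hc⟩ : ∃ e c, f ((0, 0), .ε) = (e, c) := ⟨_, _, rfl⟩ <;>
    have h0 := hfl ((0, 0), .ε) <;> rw [hc] at h0 <;> cases (hl e c).1 h0 <;>
    have h1 := hf ((0, 0), .ε) <;> have h2 := hf ((0, 0), .α) <;>
    have h3 := hfl ((0, 0), .α) <;> have h4 := hfl ((0, 0), .δ) <;> rw [hc] at h1
  · have h1 : f ((0, 0), .α) = (e, .α) := h1
    rw [h1] at h2 h3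
    have h2 : f ((0, 0), .δ) = (e, .δ) := h2
    rw [h2] at h4
    exact absurd ((h3.symm.trans (key e).1).trans h4) (by decide)
  · have h1 : f ((0, 0), .α) = (e, .γ) := h1
    rw [h1] at h2 h3
    have h2 : f ((0, 0), .δ) = (e, .β) := h2
    rw [h2] at h4
    exact absurd ((h3.symm.trans (key e).2).trans h4) (by decide)

/-! ### The vertices γ⁴ of the two further tilings -/

theorem cube_face_inv (i : Fin 6) (j : Fin 4) : cube.face⁻¹ (i, j) = (i, j - 1) := by
  rw [Equiv.Perm.inv_eq_iff_eq, cube_face, sub_add_cancel]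

theorem sameCycle_cube_ε {l : (Fin 6 × Fin 4) × Label5 → Label3} {i : Fin 6} {j : Fin 4}
    {y : (Fin 6 × Fin 4) × Label5}
    (h : (labelledSubdivision cube l).vertex.SameCycle ((i, j), .ε) y) :
    ∃ j', y = ((i, j'), .ε) := by
  have := (iff_of_sameCycle (p := fun y : (Fin 6 × Fin 4) × Label5 => y.1.1 = i ∧ y.2 = .ε)
    ?_ h).1 ⟨rfl, rfl⟩
  · exact ⟨y.1.2, by ext <;> simp [this]⟩
  · rintro ⟨⟨i', j'⟩, c⟩
    cases c <;> simp [labelledSubdivision, vertex_subdivision_ε, vertex_subdivision_α,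
      vertex_subdivision_β, vertex_subdivision_γ, vertex_subdivision_δ, cube_face_inv]

/-- In the bottom and top faces all four tiles are flipped, so they agree in direction; in the
lateral faces flipped and unflipped tiles alternate. -/
theorem isMixed_of_isFlipped {r : Label5 → Label3} (hr : r = red3D1 ∨ r = red3D3) :
    (labelledSubdivision cube (flipLabel r isFlipped)).IsMixed := by
  have hround : ∀ i j, i = 0 ∨ i = 1 →
      (labelledSubdivision cube (flipLabel r isFlipped)).IsRoundAt ((i, j), .ε) := by
    intro i j hi
    rcases hr with rfl | rfl
    · right
      intro y hy
      obtain ⟨j', rfl⟩ := sameCycle_cube_ε hy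
      change flipLabel red3D1 isFlipped ((i, j'), .ε) = .γ ∧
        flipLabel red3D1 isFlipped ((i, j'), .γ) = .β ∧
        flipLabel red3D1 isFlipped ((i, j'), .α) = .α
      clear hy
      revert i j'; decide
    · left
      intro y hy
      obtain ⟨j', rfl⟩ := sameCycle_cube_ε hy
      change flipLabel red3D3 isFlipped ((i, j'), .ε) = .γ ∧
        flipLabel red3D3 isFlipped ((i, j'), .γ) = .α ∧
        flipLabel red3D3 isFlipped ((i, j'), .α) = .β
      clear hy
      revert i j'; decide
  have hsquare : ∀ i j, ¬ (i = 0 ∨ i = 1) →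
      (labelledSubdivision cube (flipLabel r isFlipped)).IsSquareAt ((i, j), .ε) := by
    intro i j hi y hy
    obtain ⟨j', rfl⟩ := sameCycle_cube_ε hy
    have hv : (labelledSubdivision cube (flipLabel r isFlipped)).vertex ((i, j'), .ε) =
        ((i, j' - 1), .ε) := congr_arg (fun d => (d, Label5.ε)) (cube_face_inv i j')
    rw [hv]
    change flipLabel r isFlipped ((i, j'), .ε) = .γ ∧
      (flipLabel r isFlipped ((i, j'), .γ) = .α ∧ flipLabel r isFlipped ((i, j'), .α) = .β ∧
        flipLabel r isFlipped ((i, j' - 1), .γ) = .β ∧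
        flipLabel r isFlipped ((i, j' - 1), .α) = .α ∨
      flipLabel r isFlipped ((i, j'), .γ) = .β ∧ flipLabel r isFlipped ((i, j'), .α) = .α ∧
        flipLabel r isFlipped ((i, j' - 1), .γ) = .α ∧
        flipLabel r isFlipped ((i, j' - 1), .α) = .β)
    clear hy hv hround
    rcases hr with rfl | rfl <;> revert i j' <;> decide
  refine ⟨?_, ⟨_, hround 0 0 (Or.inl rfl)⟩, ⟨_, hsquare 2 0 (by decide)⟩⟩
  rintro ⟨⟨i, j⟩, c⟩ hd
  obtain rfl := (flipLabel_eq_γ hr isFlipped _ _).1 hd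
  by_cases hi : i = 0 ∨ i = 1
  · exact Or.inl (hround i j hi)
  · exact Or.inr (hsquare i j hi)

end Further

end PentTiling

theorem theorem6 :
    (∀ (D : Type*) [Fintype D] (T : LabelledMap D Label3),
      T.IsTilingFor AVC3D24 ↔
        T.Equivalent (PP6.relabel red3D1) ∨ T.Equivalent (PP6.relabel red3D2) ∨
          T.Equivalent (PP6.relabel red3D3) ∨
          T.Equivalent extraTiling3 ∨ T.Equivalent extraTiling1) ∧
    (∀ (D : Type*) [Fintype D] (T : LabelledMap D Label3),
      T.IsTilingFor AVC3D60 ↔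
        T.Equivalent (PP12.relabel red3D1) ∨ T.Equivalent (PP12.relabel red3D2) ∨
          T.Equivalent (PP12.relabel red3D3)) ∧
    ((∀ r : Label5 → Label3, ¬ extraTiling3.Equivalent (PP6.relabel r)) ∧
      (∀ r : Label5 → Label3, ¬ extraTiling1.Equivalent (PP6.relabel r)) ∧
      ¬ extraTiling3.Equivalent extraTiling1 ∧
      extraTiling3.IsMixed ∧ extraTiling1.IsMixed) := by
  refine ⟨fun D _ T => ⟨equivalent_of_isTilingFor_24, ?_⟩,
    fun D _ T => ⟨equivalent_of_isTilingFor_60, ?_⟩, ?_, ?_, not_equivalent_extraTilings,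
    isMixed_of_isFlipped (Or.inr rfl), isMixed_of_isFlipped (Or.inl rfl)⟩
  · rintro (h | h | h | h | h)
    · exact h.isTilingFor (isTilingFor_cube (isFlip_false _) (Or.inl rfl))
    · exact h.isTilingFor (isTilingFor_cube (isFlip_false _) (Or.inr (Or.inr ⟨rfl, fun _ => rfl⟩)))
    · exact h.isTilingFor (isTilingFor_cube (isFlip_false _) (Or.inr (Or.inl rfl)))
    · exact h.isTilingFor (isTilingFor_cube isFlip_isFlipped (Or.inr (Or.inl rfl)))
    · exact h.isTilingFor (isTilingFor_cube isFlip_isFlipped (Or.inl rfl))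
  · rintro (h | h | h)
    · exact h.isTilingFor (isTilingFor_dodecahedron (Or.inl rfl))
    · exact h.isTilingFor (isTilingFor_dodecahedron (Or.inr (Or.inr rfl)))
    · exact h.isTilingFor (isTilingFor_dodecahedron (Or.inr (Or.inl rfl)))
  · exact not_equivalent_relabel (flipLabel_eq_γ (Or.inr rfl) isFlipped) (d := (0, 0))
      (d' := (2, 0)) (by decide)
  · exact not_equivalent_relabel (flipLabel_eq_γ (Or.inl rfl) isFlipped) (d := (0, 0))
      (d' := (2, 0)) (by decide)
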